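/- **Conventions.** For a finite-dimensional real vector space $V$ let $\mathrm{AGr}^m(V)$ be the Grassmannian of affine subspaces of codimension $m$, with its usual topology. An *$m$-density* on $V$ is a continuous real function $\delta$ on the cone of decomposable $m$-vectors of $V$ with $\delta(t\xi)=|t|\,\delta(\xi)$ for $t\in\mathbb R$. It is *normal* if there is a signed Borel measure $\mu$ on $\mathrm{AGr}^m(V)$, finite on compact sets (i.e. a difference of two positive Borel measures finite on compact sets) and translation invariant, such that $$\delta(\xi_1\wedge\dots\wedge\xi_m)=\mu\{H\in \mathrm{AGr}^m(V) : H\cap\Pi_\xi\neq\emptyset\}\qquad(\xi_1,\dots,\xi_m\in V),$$ where $\Pi_\xi=\{\sum_i t_i\xi_i: 0\le t_i\le 1\}$. A (normal) $m$-density on a smooth manifold $X$ is a family $\delta=(\delta_x)_{x\in X}$ of (normal) $m$-densities $\delta_x$ on $T_xX$ depending continuously on $x$, that is, in local trivializations of $TX$ the value of $\delta$ is jointly continuous in the point and the $m$ vectors. The density $\delta$ *locally corresponds to a decomposable form* if every point of $X$ has an open neighborhood on which $\delta=|\omega|$ for a form $\omega=\varphi_1\wedge\dots\wedge\varphi_m$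 with continuous 1-forms $\varphi_i$ (for $m=0$: $\omega$ is any continuous function). Let $p:X\to Y$ be a smooth, locally trivial fiber bundle of smooth (Hausdorff, second countable) manifolds whose fibers $F_y=p^{-1}(y)$ are compact manifolds of dimension $k\le m$. The *push-forward* $p_*\delta$ of an $m$-density $\delta$ on $X$ is given by $$(p_*\delta)_y(\eta_1\wedge\dots\wedge\eta_{m-k})=\int_{F_y}\xi\lrcorner\,\delta,\qquad (\xi\lrcorner\,\delta)(f_1\wedge\dots\wedge f_k)=\delta_x(\xi_1\wedge\dots\wedge\xi_{m-k}\wedge f_1\wedge\dots\wedge f_k),$$ where $\eta_i\in T_yY$, and for $x\in F_y$ the $f_j\in T_xF_y$ are tangent to the fiber and $\xi_i\in T_xX$ are arbitrary vectors with $dp_x(\xi_i)=\eta_i$. **Theorem.** Let $\delta$ be a normal $m$-density on $X$ which locally corresponds to a decomposable form, and let $p:X\to Y$ be a smooth, locally trivial fiber bundle whose fibers are compact manifolds of dimension $k\le m$. Then the push-forward $p_*\delta$ is a normal $(m-k)$-density on $Y$. -/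

import Mathlib

open Set MeasureTheory Bundle
open scoped Manifold ContDiff Topology

noncomputable section

namespace NormalDensity

/-! ### Affine Grassmannian and normal measures -/

section Linear

variable (m : ℕ) (V : Type*) [AddCommGroup V] [Module ℝ V]

/-- The affine Grassmannian `AGr^m(V)`: (nonempty) affine subspaces of `V` of codimension `m`.
It is used for finite dimensional `V` only. -/
def AffGr : Type _ :=
  {H : AffineSubspace ℝ V // (H : Set V).Nonempty ∧ FiniteDimensional ℝ (V ⧸ H.direction) ∧
    Module.finrank ℝ (V ⧸ H.direction) = m}

variable {m V}

/-- The set of points of an affine subspace. -/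
def AffGr.points (H : AffGr m V) : Set V := (H.1 : Set V)

/-- Translation of affine subspaces by a vector `v`. -/
def AffGr.translate (v : V) (H : AffGr m V) : AffGr m V :=
  ⟨H.1.map (AffineEquiv.constVAdd ℝ V v : V →ᵃ[ℝ] V), by
    have hdir : (H.1.map (AffineEquiv.constVAdd ℝ V v : V →ᵃ[ℝ] V)).direction
        = H.1.direction := by
      rw [AffineSubspace.map_direction]
      exact Submodule.map_id _
    refine ⟨?_, ?_⟩
    · rw [AffineSubspace.coe_map]
      exact H.2.1.image _
    · rw [hdir]
      exact H.2.2⟩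

/-- The family `J_{m,D}` of affine subspaces of codimension `m` meeting `D`. -/
def hitting (m : ℕ) (D : Set V) : Set (AffGr m V) := {H | (H.points ∩ D).Nonempty}

variable [TopologicalSpace V]

/-- The affine subspace with equations `φ i v = c i`, where the functionals
`φ i` are linearly independent. -/
def levelSubspace (z : {φ : Fin m → (V →L[ℝ] ℝ) // LinearIndependent ℝ φ} × (Fin m → ℝ)) :
    AffineSubspace ℝ V where
  carrier := {v | ∀ i, z.1.1 i v = z.2 i}
  smul_vsub_vadd_mem' := by
    intro t p₁ p₂ p₃ h₁ h₂ h₃ i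
    simp [h₁ i, h₂ i, h₃ i]

lemma pi_surjective {φ : Fin m → (V →L[ℝ] ℝ)} (h : LinearIndependent ℝ φ) :
    Function.Surjective (LinearMap.pi fun i => (φ i : V →ₗ[ℝ] ℝ)) := by
  rw [← LinearMap.range_eq_top]
  by_contra hne
  obtain ⟨f, hf, hle⟩ := Submodule.exists_le_ker_of_lt_top _ (lt_top_iff_ne_top.2 hne)
  have hsum : ∀ w : Fin m → ℝ, f w = ∑ i, w i * f (Pi.single i 1) := by
    intro w
    conv_lhs => rw [pi_eq_sum_univ' w]
    simp [map_sum]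
  have hz : ∑ i, f (Pi.single i 1) • φ i = 0 := by
    ext v
    have hv : f (LinearMap.pi (fun i => (φ i : V →ₗ[ℝ] ℝ)) v) = 0 :=
      hle (LinearMap.mem_range_self _ v)
    rw [hsum] at hv
    simpa [mul_comm] using hv
  have h0 := Fintype.linearIndependent_iff.1 h _ hz
  apply hf
  ext w
  simp [h0]

lemma levelSubspace_spec
    (z : {φ : Fin m → (V →L[ℝ] ℝ) // LinearIndependent ℝ φ} × (Fin m → ℝ)) :
    (levelSubspace z : Set V).Nonempty ∧ FiniteDimensional ℝ (V ⧸ (levelSubspace z).direction) ∧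
      Module.finrank ℝ (V ⧸ (levelSubspace z).direction) = m := by
  have hs := pi_surjective z.1.2
  obtain ⟨v₀, hv₀⟩ := hs z.2
  have hmem : v₀ ∈ levelSubspace z := fun i => congrFun hv₀ i
  have hdir : (levelSubspace z).direction
      = LinearMap.ker (LinearMap.pi fun i => (z.1.1 i : V →ₗ[ℝ] ℝ)) := by
    ext v
    rw [← AffineSubspace.vadd_mem_iff_mem_direction v hmem]
    constructor
    · intro hv
      ext i
      have h1 : z.1.1 i (v +ᵥ v₀) = z.2 i := hv i
      have h2 : z.1.1 i v₀ = z.2 i := hmem i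
      have : z.1.1 i v + z.1.1 i v₀ = z.2 i := by simpa using h1
      simpa using (by linarith : z.1.1 i v = 0)
    · intro hv i
      have h1 : z.1.1 i v = 0 := congrFun hv i
      have h2 : z.1.1 i v₀ = z.2 i := hmem i
      simp [h1, h2]
  let e := LinearMap.quotKerEquivOfSurjective _ hs
  rw [hdir]
  exact ⟨⟨v₀, hmem⟩, Module.Finite.equiv e.symm, by rw [e.finrank_eq]; simp⟩

/-- The parametrization of `AGr^m(V)` by systems of `m` independent linear equations. -/
def ofEquations (z : {φ : Fin m → (V →L[ℝ] ℝ) // LinearIndependent ℝ φ} × (Fin m → ℝ)) :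
    AffGr m V :=
  ⟨levelSubspace z, levelSubspace_spec z⟩

/-- The usual topology of `AGr^m(V)`, as a quotient of the space of independent systems of `m`
linear equations. -/
instance : TopologicalSpace (AffGr m V) := TopologicalSpace.coinduced ofEquations inferInstance

instance : MeasurableSpace (AffGr m V) := borel _

instance : BorelSpace (AffGr m V) := ⟨rfl⟩

variable (m V) in
/-- A normal measure on `AGr^m(V)`: a translation invariant signed Borel measure which is finite
on compact sets, given as a difference `pos - neg` of two positive Borel measures which are finite
on compact sets. The last field says that `pos - neg` is translation invariant. -/
structure NormalMeasure where
  pos : Measure (AffGr m V)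
  neg : Measure (AffGr m V)
  pos_finite : IsFiniteMeasureOnCompacts pos
  neg_finite : IsFiniteMeasureOnCompacts neg
  invariant : ∀ (v : V) (B : Set (AffGr m V)), MeasurableSet B →
    pos (AffGr.translate v ⁻¹' B) + neg B = pos B + neg (AffGr.translate v ⁻¹' B)

/-- The signed measure of a (relatively compact) set. -/
def NormalMeasure.eval (μ : NormalMeasure m V) (B : Set (AffGr m V)) : ℝ :=
  μ.pos.real B - μ.neg.real B

/-- The map `χ_m`: the value on `ξ₁ ∧ … ∧ ξ_m` is the measure of the set of affine subspaces
meeting the parallelotope generated by `ξ₁, …, ξ_m`. -/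
def NormalMeasure.chi (μ : NormalMeasure m V) (ξ : Fin m → V) : ℝ :=
  μ.eval (hitting m (parallelepiped ξ))

/-- An `m`-density on `V`: a continuous function `δ` on decomposable `m`-vectors with
`δ (t ξ) = |t| δ ξ`. It is written as a function of `(ξ₁, …, ξ_m)`; by `homog` (with `t = 1`) it
depends on `ξ₁ ∧ … ∧ ξ_m` only. -/
structure IsDensity (δ : (Fin m → V) → ℝ) : Prop where
  continuous : Continuous δ
  homog : ∀ (t : ℝ) (ξ η : Fin m → V),
    exteriorPower.ιMulti ℝ m ξ = t • exteriorPower.ιMulti ℝ m η → δ ξ = |t| * δ η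

/-- A density on `V` is normal if it is `χ_m μ` for a normal measure `μ`. -/
def IsNormal (δ : (Fin m → V) → ℝ) : Prop :=
  IsDensity δ ∧ ∃ μ : NormalMeasure m V, ∀ ξ, δ ξ = μ.chi ξ

/-- The wedge product `φ₁ ∧ … ∧ φ_m` of linear forms:
its value on `(ξ₁, …, ξ_m)` is `det (φ_i (ξ_j))`. -/
def wedge (φ : Fin m → (V →L[ℝ] ℝ)) : V [⋀^Fin m]→ₗ[ℝ] ℝ :=
  Matrix.detRowAlternating.compLinearMap (LinearMap.pi fun i => (φ i : V →ₗ[ℝ] ℝ))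

end Linear

/-! ### Densities on manifolds -/

section Manifold

/-- A field of functions of `m` tangent vectors on an `n`-dimensional manifold `X`. -/
abbrev TangentFunction (n m : ℕ) (X : Type*) [TopologicalSpace X]
    [ChartedSpace (EuclideanSpace ℝ (Fin n)) X] : Type _ :=
  ∀ x : X, (Fin m → TangentSpace (𝓡 n) x) → ℝ

variable {n m : ℕ} {X : Type*} [TopologicalSpace X] [ChartedSpace (EuclideanSpace ℝ (Fin n)) X]
  [IsManifold (𝓡 n) ∞ X]

/-- `x ↦ δ_x` is continuous: in the standard local trivializations of the tangent bundle,
`δ_x (v₁, …, v_m)` is a continuous function of `x` and `v₁, …, v_m`. -/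
def IsContinuousField (δ : TangentFunction n m X) : Prop :=
  ∀ x₀ : X, ContinuousOn
    (fun z : X × (Fin m → EuclideanSpace ℝ (Fin n)) =>
      δ z.1 fun i =>
        (trivializationAt (EuclideanSpace ℝ (Fin n)) (TangentSpace (𝓡 n)) x₀).symm z.1 (z.2 i))
    ((trivializationAt (EuclideanSpace ℝ (Fin n)) (TangentSpace (𝓡 n)) x₀).baseSet ×ˢ univ)

/-- An `m`-density on the manifold `X`. -/
structure IsDensityField (δ : TangentFunction n m X) : Prop where
  density : ∀ x, IsDensity (δ x)
  continuous : IsContinuousField δ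

/-- A normal `m`-density on the manifold `X`: a continuous field `x ↦ δ_x` of normal densities on
the tangent spaces. -/
structure IsNormalField (δ : TangentFunction n m X) : Prop where
  normal : ∀ x, IsNormal (δ x)
  continuous : IsContinuousField δ

/-- `δ` locally corresponds to a decomposable form: every point has an open neighborhood `U` with
`δ = |c φ₁ ∧ … ∧ φ_m|` on `U`, where `φ_i` are continuous 1-forms on `U`. The continuous
coefficient `c` matters for `m = 0` only, where it makes all functions decomposable forms;
if `m > 0` it can be absorbed in `φ₁`. -/
def LocallyDecomposable (δ : TangentFunction n m X) : Prop :=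
  ∀ x₀ : X, ∃ U : Set X, IsOpen U ∧ x₀ ∈ U ∧
    ∃ (c : X → ℝ) (φ : Fin m → ∀ x : X, TangentSpace (𝓡 n) x →L[ℝ] ℝ),
      ContinuousOn c U ∧
      (∀ i, ContinuousOn (fun v : TangentBundle (𝓡 n) X => φ i v.proj v.2)
        (TotalSpace.proj ⁻¹' U)) ∧
      ∀ x ∈ U, ∀ ξ : Fin m → TangentSpace (𝓡 n) x,
        δ x ξ = |c x * wedge (fun i => φ i x) ξ|

end Manifold

/-! ### Integration of top-order densities over compact manifolds -/

section Integral

variable (k : ℕ) (M : Type*) [TopologicalSpace M] [ChartedSpace (EuclideanSpace ℝ (Fin k)) M]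
  [IsManifold (𝓡 k) ∞ M] [CompactSpace M] [T2Space M]

/-- A smooth partition of unity subordinate to the atlas of `M`. -/
def chartPartition : SmoothPartitionOfUnity M (𝓡 k) M univ :=
  (SmoothPartitionOfUnity.exists_isSubordinate_chartAt_source (𝓡 k) M).choose

lemma chartPartition_isSubordinate :
    (chartPartition k M).IsSubordinate fun x => (chartAt (EuclideanSpace ℝ (Fin k)) x).source :=
  (SmoothPartitionOfUnity.exists_isSubordinate_chartAt_source (𝓡 k) M).choose_spec

variable {k M}

/-- The coordinate tangent vectors of the chart at `i`, at the point with coordinates `u`. -/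
def coordVectors (i : M) (u : EuclideanSpace ℝ (Fin k)) (j : Fin k) :
    TangentSpace (𝓡 k) ((extChartAt (𝓡 k) i).symm u) :=
  mfderiv (𝓡 k) (𝓡 k) (extChartAt (𝓡 k) i).symm u (EuclideanSpace.single j (1 : ℝ))

/-- The integral of a continuous top-order density `ρ` over the compact manifold `M`: the sum over
charts, weighted with a partition of unity, of the Lebesgue integrals of `ρ (∂₁, …, ∂_k)`. -/
def integral (ρ : TangentFunction k k M) : ℝ :=
  ∑ᶠ i : M, ∫ u in (extChartAt (𝓡 k) i).target,
    chartPartition k M i ((extChartAt (𝓡 k) i).symm u) *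
      ρ ((extChartAt (𝓡 k) i).symm u) (coordVectors i u)

end Integral

/-! ### Fiber bundles and push-forward -/

section Bundle

variable {n l k q : ℕ}
  {X : Type*} [TopologicalSpace X] [ChartedSpace (EuclideanSpace ℝ (Fin n)) X]
  {Y : Type*} [TopologicalSpace Y] [ChartedSpace (EuclideanSpace ℝ (Fin l)) Y]
  {F : Y → Type*} [∀ y, TopologicalSpace (F y)]
  [∀ y, ChartedSpace (EuclideanSpace ℝ (Fin k)) (F y)]

/-- Smooth local trivializations making `p : X → Y` a smooth, locally trivial fiber bundle:
near every `y`, the map `p` is diffeomorphic to the projection of a product with fiber `F y`. -/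
structure SmoothFiberBundle (n l k : ℕ)
    {X : Type*} [TopologicalSpace X] [ChartedSpace (EuclideanSpace ℝ (Fin n)) X]
    {Y : Type*} [TopologicalSpace Y] [ChartedSpace (EuclideanSpace ℝ (Fin l)) Y]
    (p : X → Y) (F : Y → Type*) [∀ y, TopologicalSpace (F y)]
    [∀ y, ChartedSpace (EuclideanSpace ℝ (Fin k)) (F y)] where
  triv : ∀ y, Trivialization (F y) p
  mem_baseSet : ∀ y, y ∈ (triv y).baseSet
  contMDiffOn : ∀ y, ContMDiffOn (𝓡 n) ((𝓡 l).prod (𝓡 k)) ∞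
    (triv y).toOpenPartialHomeomorph (triv y).source
  contMDiffOn_symm : ∀ y, ContMDiffOn ((𝓡 l).prod (𝓡 k)) (𝓡 n) ∞
    (triv y).toOpenPartialHomeomorph.symm (triv y).target

variable {p : X → Y}

/-- The diffeomorphism of `F y` onto the fiber `p ⁻¹ {y} ⊆ X`. -/
def SmoothFiberBundle.fiberMap (B : SmoothFiberBundle n l k p F) (y : Y) (z : F y) : X :=
  (B.triv y).toOpenPartialHomeomorph.symm (y, z)

/-- Some tangent vector `ξ ∈ T_x X` with `dp_x ξ = η`, where `η ∈ T_y Y` and `p x = y`. -/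
def lift (n l : ℕ)
    {X : Type*} [TopologicalSpace X] [ChartedSpace (EuclideanSpace ℝ (Fin n)) X]
    {Y : Type*} [TopologicalSpace Y] [ChartedSpace (EuclideanSpace ℝ (Fin l)) Y]
    (p : X → Y) (x : X) {y : Y} (η : TangentSpace (𝓡 l) y) : TangentSpace (𝓡 n) x :=
  Classical.epsilon fun ξ : TangentSpace (𝓡 n) x =>
    tangentMap (𝓡 n) (𝓡 l) p ⟨x, ξ⟩ = (⟨y, η⟩ : TangentBundle (𝓡 l) Y)

/-- The density `ξ ⌟ δ` on the fiber over `y`, transported to `F y`, where `ξ₁, …, ξ_q` are lifts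
of `η₁, …, η_q`: its value on `f₁, …, f_k` is `δ (ξ₁ ∧ … ∧ ξ_q ∧ f₁ ∧ … ∧ f_k)`. -/
def fiberDensity (B : SmoothFiberBundle n l k p F) (δ : TangentFunction n (q + k) X)
    (y : Y) (η : Fin q → TangentSpace (𝓡 l) y) : TangentFunction k k (F y) :=
  fun z f => δ (B.fiberMap y z) <|
    Fin.append (fun i => lift n l p (B.fiberMap y z) (η i))
      (fun j => mfderiv (𝓡 k) (𝓡 n) (B.fiberMap y) z (f j))

/-- The push-forward `p_* δ`, a density of order `q` on `Y`, of a density of order `q + k`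
on `X`. -/
def pushforward [∀ y, IsManifold (𝓡 k) ∞ (F y)] [∀ y, CompactSpace (F y)] [∀ y, T2Space (F y)]
    (B : SmoothFiberBundle n l k p F) (δ : TangentFunction n (q + k) X) :
    TangentFunction l q Y :=
  fun y η => integral (fiberDensity B δ y η)

end Bundle

end NormalDensity

end

noncomputable section

namespace NormalDensity

/-! ### Linear algebra of decomposable forms -/

section Decomposable

variable {V : Type*} [AddCommGroup V] [Module ℝ V] [TopologicalSpace V] {q k m : ℕ}

/-! Normality is a statement about one tangent space at a time, and the model case is a single form.
If `ψ₁, …, ψ_q` are linear forms on `V`, send `c ∈ ℝ^q` to the affine subspace `{ψ = c}`. This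
subspace meets a parallelotope exactly when `c` lies in its image under `ψ`, whose volume is `|det
(ψ_i (ξ_j))|`. So the image of Lebesgue measure represents `|ψ₁ ∧ … ∧ ψ_q|`, and it is translation
invariant because translating a subspace shifts `c`. The same works for an average of such functions
over a finite measure on bounded systems of forms (`exists_normalMeasure`); these averages are
called mixtures.

The push-forward is a mixture at every point. Contracting a decomposable form with the fiber vectors
`f` gives a decomposable form whose factors vanish on `f` (`exists_contraction`). Hence the
integrand does not depend on the lifts, and in coordinates it is, for each point of the fiber, the
absolute value of a decomposable form on `T_y Y`. To turn the fiber integral into a mixture the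
factors must be chosen measurably and boundedly, although only the absolute value is given
(`isMixture_integral`). Choose basis vectors `e` maximizing the density, and normalize the factors
to be dual to `e`: polarization recovers them from the density, and maximality bounds their
coefficients by 1.

For continuity in `y` the fiber has to be held fixed. The integral of a density is invariant under
diffeomorphisms (`integral_comp_diffeo`), so near `y₀` the integral over `F y` can be moved to `F
y₀` (`pushforward_eq_sum`). There it is a finite sum of integrals with compact support and
continuous dependence on parameters. -/

lemma wedge_apply (φ : Fin m → (V →L[ℝ] ℝ)) (ξ : Fin m → V) :
    wedge φ ξ = (Matrix.of fun i j => φ i (ξ j)).det := by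
  rw [← Matrix.det_transpose]
  rfl

/-- The linear change of the forms `φ i` by a matrix. -/
def matrixComb {ι : Type*} (G : Matrix ι (Fin m) ℝ) (φ : Fin m → (V →L[ℝ] ℝ)) (i : ι) :
    V →L[ℝ] ℝ := ∑ j, G i j • φ j

lemma matrixComb_apply {ι : Type*} (G : Matrix ι (Fin m) ℝ) (φ : Fin m → (V →L[ℝ] ℝ)) (i : ι)
    (v : V) : matrixComb G φ i v = ∑ j, G i j * φ j v := by
  simp [matrixComb]

lemma of_matrixComb {ι κ : Type*} (G : Matrix ι (Fin m) ℝ) (φ : Fin m → (V →L[ℝ] ℝ))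
    (ξ : κ → V) :
    (Matrix.of fun i j => matrixComb G φ i (ξ j)) = G * Matrix.of fun i j => φ i (ξ j) := by
  ext i j
  simp [matrixComb_apply, Matrix.mul_apply]

/-- If `φ₁ ∧ … ∧ φ_m` does not vanish on `e`, the forms can be replaced by a dual system of `e`. -/
lemma exists_dual_wedge (φ : Fin m → (V →L[ℝ] ℝ)) (e : Fin m → V) (h : wedge φ e ≠ 0) :
    ∃ ψ : Fin m → (V →L[ℝ] ℝ), (∀ i j, ψ i (e j) = if i = j then 1 else 0) ∧
      ∀ ξ, wedge φ ξ = wedge φ e * wedge ψ ξ := by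
  set A : Matrix (Fin m) (Fin m) ℝ := Matrix.of fun i j => φ i (e j) with hA
  have hdet : A.det ≠ 0 := by rwa [wedge_apply] at h
  have hu : IsUnit A.det := isUnit_iff_ne_zero.2 hdet
  -- The forms `A⁻¹ φ` take the values `A⁻¹ A = 1` on `e`, and the factor `det A = wedge φ e`
  -- restores the original wedge product.
  refine ⟨matrixComb A⁻¹ φ, ?_, ?_⟩
  · intro i j
    have := congrFun (congrFun (of_matrixComb A⁻¹ φ e) i) j
    rw [← hA, Matrix.nonsing_inv_mul _ hu, Matrix.one_apply] at this
    exact this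
  · intro ξ
    rw [wedge_apply (matrixComb A⁻¹ φ), of_matrixComb, Matrix.det_mul, wedge_apply φ e,
      ← mul_assoc, ← Matrix.det_mul, Matrix.mul_nonsing_inv _ hu, Matrix.det_one, one_mul,
      wedge_apply]

/-- Contraction of a decomposable form with the vectors `f`: the result is decomposable, with
factors vanishing on `f`. -/
lemma exists_contraction (φ : Fin (q + k) → (V →L[ℝ] ℝ)) (f : Fin k → V) :
    ∃ (c : ℝ) (ψ : Fin q → (V →L[ℝ] ℝ)), (∀ i j, ψ i (f j) = 0) ∧
      ∀ ξ, wedge φ (Fin.append ξ f) = c * wedge ψ ξ := by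
  by_cases h : ∃ ξ : Fin q → V, wedge φ (Fin.append ξ f) ≠ 0
  · obtain ⟨ξ₀, h₀⟩ := h
    obtain ⟨ψ, hψ, hφ⟩ := exists_dual_wedge φ _ h₀
    have hf : ∀ i j, ψ i (f j) = if i = Fin.natAdd q j then 1 else 0 := by
      intro i j
      simpa using hψ i (Fin.natAdd q j)
    -- `ψ` is dual to `ξ₀, f`. Its first `q` forms vanish on `f`, and its last `k` forms are dual to
    -- `f`; so the matrix of `ψ` on `ξ, f` is block triangular with lower right block 1.
    refine ⟨wedge φ (Fin.append ξ₀ f), fun i => ψ (Fin.castAdd k i), ?_, ?_⟩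
    · intro i j
      rw [hf, if_neg]
      intro h
      have := congrArg Fin.val h
      simp at this
      omega
    · intro ξ
      rw [hφ]
      congr 1
      have h12 : ((Matrix.of fun i j => ψ i ((Fin.append ξ f : Fin (q + k) → V) j)).submatrix
          finSumFinEquiv finSumFinEquiv).toBlocks₁₂ = 0 := by
        ext i j
        simp only [Matrix.toBlocks₁₂, Matrix.of_apply, Matrix.submatrix_apply,
          finSumFinEquiv_apply_left, finSumFinEquiv_apply_right, Fin.append_right, hf,
          Matrix.zero_apply]
        rw [if_neg]
        intro h
        have := congrArg Fin.val h
        simp at this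
        omega
      have h22 : ((Matrix.of fun i j => ψ i ((Fin.append ξ f : Fin (q + k) → V) j)).submatrix
          finSumFinEquiv finSumFinEquiv).toBlocks₂₂ = 1 := by
        ext i j
        simp [Matrix.toBlocks₂₂, hf, Matrix.one_apply]
      rw [wedge_apply ψ, ← Matrix.det_submatrix_equiv_self finSumFinEquiv,
        ← Matrix.fromBlocks_toBlocks ((Matrix.of _).submatrix _ _), h12, h22,
        Matrix.det_fromBlocks_zero₁₂, Matrix.det_one, mul_one, wedge_apply]
      congr 1
      ext i j
      simp [Matrix.toBlocks₁₁]
  · push Not at h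
    exact ⟨0, 0, by simp, fun ξ => by simp [h]⟩

/-- Effect of a linear change of the last `k` vectors on an alternating form. -/
lemma wedge_append_comb (φ : Fin (q + k) → (V →L[ℝ] ℝ)) (ξ : Fin q → V) (f : Fin k → V)
    (A : Matrix (Fin k) (Fin k) ℝ) :
    wedge φ (Fin.append ξ fun b => ∑ a, A a b • f a) = A.det * wedge φ (Fin.append ξ f) := by
  -- Changing only the last `k` vectors multiplies the matrix on the right by the block diagonal
  -- matrix with blocks `1` and `A`.
  have key : (Matrix.of fun i j => φ i ((Fin.append ξ fun b => ∑ a, A a b • f a) j)) =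
      (Matrix.of fun i j => φ i ((Fin.append ξ f : Fin (q + k) → V) j)) *
        (Matrix.fromBlocks 1 0 0 A).submatrix finSumFinEquiv.symm finSumFinEquiv.symm := by
    ext i j
    rw [Matrix.mul_apply, ← finSumFinEquiv.sum_comp, Fintype.sum_sum_type]
    refine Fin.addCases (fun j => ?_) (fun j => ?_) j
    · simp [Matrix.one_apply]
    · simp [mul_comm]
  rw [wedge_apply, wedge_apply, key, Matrix.det_mul, Matrix.det_submatrix_equiv_self,
    Matrix.det_fromBlocks_zero₁₂, Matrix.det_one, one_mul, mul_comm]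

/-- Replacing one vector in a dual system. -/
lemma wedge_update_of_dual (ψ : Fin m → (V →L[ℝ] ℝ)) (e : Fin m → V)
    (h : ∀ i j, ψ i (e j) = if i = j then 1 else 0) (i : Fin m) (v : V) :
    wedge ψ (Function.update e i v) = ψ i v := by
  have key : (Matrix.of fun a b => ψ a (Function.update e i v b)) =
      (1 : Matrix (Fin m) (Fin m) ℝ).updateCol i fun a => ψ a v := by
    ext a b
    by_cases hb : b = i
    · subst hb; simp
    · simp [hb, h, Matrix.one_apply]
  rw [wedge_apply, key, ← Matrix.cramer_apply, Matrix.cramer_one]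
  rfl

lemma linearIndependent_of_wedge_ne_zero (φ : Fin m → (V →L[ℝ] ℝ)) (e : Fin m → V)
    (h : wedge φ e ≠ 0) : LinearIndependent ℝ φ := by
  rw [Fintype.linearIndependent_iff]
  intro g hg
  by_contra hne
  push Not at hne
  apply h
  rw [wedge_apply, ← Matrix.exists_vecMul_eq_zero_iff]
  refine ⟨g, fun h0 => ?_, ?_⟩
  · obtain ⟨i, hi⟩ := hne
    exact hi (congrFun h0 i)
  · ext j
    have := congrArg (fun x : V →L[ℝ] ℝ => x (e j)) hg
    simpa [Matrix.vecMul, dotProduct] using this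

/-- An alternating map factors linearly through the exterior power. This yields the homogeneity of
mixtures. -/
lemma wedge_eq_smul_of_ιMulti_eq (φ : Fin m → (V →L[ℝ] ℝ)) (t : ℝ) (ξ η : Fin m → V)
    (h : exteriorPower.ιMulti ℝ m ξ = t • exteriorPower.ιMulti ℝ m η) :
    wedge φ ξ = t * wedge φ η := by
  have := congrArg (exteriorPower.alternatingMapLinearEquiv (wedge φ)) h
  simpa using this

end Decomposable

/-! ### The measure on the affine Grassmannian defined by a measure on systems of linear forms -/

section LevelMeasure

variable {V : Type*} [NormedAddCommGroup V] [NormedSpace ℝ V] {q : ℕ}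

lemma ofEquations_mem_hitting {D : Set V}
    {z : {φ : Fin q → (V →L[ℝ] ℝ) // LinearIndependent ℝ φ} × (Fin q → ℝ)} :
    ofEquations z ∈ hitting q D ↔ ∃ v ∈ D, (fun i => z.1.1 i v) = z.2 := by
  constructor
  · rintro ⟨v, h1, h2⟩
    exact ⟨v, h2, funext h1⟩
  · rintro ⟨v, h1, h2⟩
    exact ⟨v, fun i => congrFun h2 i, h1⟩

lemma continuous_equation (i : Fin q) : Continuous fun z :
    {φ : Fin q → (V →L[ℝ] ℝ) // LinearIndependent ℝ φ} × (Fin q → ℝ) => z.1.1 i :=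
  (continuous_apply i).comp (continuous_subtype_val.comp continuous_fst)

lemma continuous_equation_apply (i : Fin q) (v : V) : Continuous fun z :
    {φ : Fin q → (V →L[ℝ] ℝ) // LinearIndependent ℝ φ} × (Fin q → ℝ) => z.1.1 i v :=
  (continuous_equation i).clm_apply continuous_const

/-- The incidence relation is closed in the product with `D`, and projection along a compact factor
is a closed map. In particular the set is Borel. -/
lemma isClosed_hitting {D : Set V} (hD : IsCompact D) : IsClosed (hitting q D) := by
  rw [isClosed_coinduced]
  have : CompactSpace D := isCompact_iff_compactSpace.1 hD
  have hc : IsClosed {w : ({φ : Fin q → (V →L[ℝ] ℝ) // LinearIndependent ℝ φ} × (Fin q → ℝ)) × D |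
      (fun i => w.1.1.1 i w.2) = w.1.2} := by
    apply isClosed_eq
    · refine continuous_pi fun i => ?_
      exact ((continuous_equation i).comp continuous_fst).clm_apply
        (continuous_subtype_val.comp continuous_snd)
    · fun_prop
  convert isClosedMap_fst_of_compactSpace _ hc using 1
  ext z
  rw [mem_preimage, ofEquations_mem_hitting]
  constructor
  · rintro ⟨v, hv, h⟩
    exact ⟨(z, ⟨v, hv⟩), h, rfl⟩
  · rintro ⟨⟨z', v⟩, h, rfl⟩
    exact ⟨v, v.2, h⟩

/-- The subspaces meeting an open set form an open set. -/
lemma isOpen_hitting {D : Set V} (hD : IsOpen D) : IsOpen (hitting q D) := by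
  rw [isOpen_coinduced, isOpen_iff_mem_nhds]
  rintro z₀ hz₀
  rw [mem_preimage, ofEquations_mem_hitting] at hz₀
  obtain ⟨v₀, hv₀, h₀⟩ := hz₀
  have hs := pi_surjective z₀.1.2
  -- The `w j` are dual to the forms of `z₀`. For nearby `z` the matrix `M z` of its forms on `w` is
  -- still invertible, so a point `v₀ + ∑ t_j w_j` of the subspace can be solved for. It depends
  -- continuously on `z` at `z₀` and equals `v₀` there, hence stays in `D`.
  choose w hw using fun j : Fin q => hs (Pi.single j 1)
  let M : {φ : Fin q → (V →L[ℝ] ℝ) // LinearIndependent ℝ φ} × (Fin q → ℝ) →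
    Matrix (Fin q) (Fin q) ℝ := fun z => Matrix.of fun i j => z.1.1 i (w j)
  have hM : Continuous M := continuous_matrix fun i j => continuous_equation_apply i (w j)
  have hM₀ : M z₀ = 1 := by
    ext i j
    have := congrFun (hw j) i
    simp only [LinearMap.pi_apply] at this
    rw [Matrix.one_apply, ← Pi.single_apply]
    exact this
  let t : {φ : Fin q → (V →L[ℝ] ℝ) // LinearIndependent ℝ φ} × (Fin q → ℝ) → Fin q → ℝ :=
    fun z => (M z)⁻¹.mulVec (z.2 - fun i => z.1.1 i v₀)
  have hdet₀ : (M z₀).det ≠ 0 := by rw [hM₀]; simp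
  have ht : ContinuousAt t z₀ := by
    have h1 : ContinuousAt (fun z => (M z)⁻¹) z₀ := by
      refine ContinuousAt.comp (g := fun A : Matrix (Fin q) (Fin q) ℝ => A⁻¹) ?_ hM.continuousAt
      apply continuousAt_matrix_inv
      simpa using NormedRing.inverse_continuousAt (Units.mk0 _ hdet₀)
    have h2 : Continuous fun z : {φ : Fin q → (V →L[ℝ] ℝ) // LinearIndependent ℝ φ} ×
        (Fin q → ℝ) => (z.2 - fun i => z.1.1 i v₀) :=
      continuous_snd.sub (continuous_pi fun i => continuous_equation_apply i v₀)
    have h3 : Continuous fun x : Matrix (Fin q) (Fin q) ℝ × (Fin q → ℝ) => x.1.mulVec x.2 :=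
      continuous_fst.matrix_mulVec continuous_snd
    exact h3.continuousAt.comp (h1.prodMk h2.continuousAt)
  let v : {φ : Fin q → (V →L[ℝ] ℝ) // LinearIndependent ℝ φ} × (Fin q → ℝ) → V :=
    fun z => v₀ + ∑ j, t z j • w j
  have hv : ContinuousAt v z₀ := by
    have h1 : Continuous fun s : Fin q → ℝ => v₀ + ∑ j, s j • w j := by fun_prop
    exact h1.continuousAt.comp ht
  have ht₀ : t z₀ = 0 := by
    simp only [t]
    rw [h₀, sub_self, Matrix.mulVec_zero]
  have hvz₀ : v z₀ = v₀ := by simp [v, ht₀]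
  have e1 : ∀ᶠ z in 𝓝 z₀, v z ∈ D := hv (by rw [hvz₀]; exact hD.mem_nhds hv₀)
  have e2 : ∀ᶠ z in 𝓝 z₀, (M z).det ≠ 0 :=
    hM.matrix_det.continuousAt.eventually_ne hdet₀
  filter_upwards [e1, e2] with z h1 h2
  rw [mem_preimage, ofEquations_mem_hitting]
  refine ⟨v z, h1, ?_⟩
  have h3 : (M z).mulVec (t z) = z.2 - fun i => z.1.1 i v₀ := by
    simp only [t]
    rw [Matrix.mulVec_mulVec, Matrix.mul_nonsing_inv _ (isUnit_iff_ne_zero.2 h2),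
      Matrix.one_mulVec]
  ext i
  have h4 := congrFun h3 i
  simp only [Matrix.mulVec, dotProduct, M, Matrix.of_apply, Pi.sub_apply] at h4
  simp only [v, map_add, map_sum, map_smul, smul_eq_mul]
  simp only [mul_comm] at h4 ⊢
  linarith

lemma translate_ofEquations (v : V)
    (z : {φ : Fin q → (V →L[ℝ] ℝ) // LinearIndependent ℝ φ} × (Fin q → ℝ)) :
    AffGr.translate v (ofEquations z) = ofEquations (z.1, (fun i => z.1.1 i v) + z.2) := by
  apply Subtype.ext
  ext x
  simp only [AffGr.translate, ofEquations]
  rw [AffineSubspace.mem_map]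
  constructor
  · rintro ⟨y, hy, rfl⟩ i
    have : z.1.1 i y = z.2 i := hy i
    simp [this]
  · intro hx
    refine ⟨x - v, fun i => ?_, by simp⟩
    have : z.1.1 i x = z.1.1 i v + z.2 i := hx i
    simp [this]

lemma continuous_translate (v : V) : Continuous (AffGr.translate (m := q) v) := by
  rw [continuous_coinduced_dom]
  have : AffGr.translate v ∘ ofEquations = ofEquations ∘ fun z :
      {φ : Fin q → (V →L[ℝ] ℝ) // LinearIndependent ℝ φ} × (Fin q → ℝ) =>
      (z.1, (fun i => z.1.1 i v) + z.2) := funext (translate_ofEquations v)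
  rw [this]
  refine continuous_coinduced_rng.comp ?_
  exact continuous_fst.prodMk
    (Continuous.add (continuous_pi fun i => continuous_equation_apply i v) continuous_snd)

/-- The image is a parallelotope in `ℝ^q`, namely the image of the unit cube under the matrix `φ_i
(ξ_j)`. -/
lemma volume_image_parallelepiped (φ : Fin q → (V →L[ℝ] ℝ)) (ξ : Fin q → V) :
    volume ((fun v i => φ i v) '' parallelepiped ξ) = ENNReal.ofReal |wedge φ ξ| := by
  have h1 : (fun v i => φ i v) '' parallelepiped ξ =
      parallelepiped ((LinearMap.pi fun i => (φ i : V →ₗ[ℝ] ℝ)) ∘ ξ) :=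
    image_parallelepiped (LinearMap.pi fun i => (φ i : V →ₗ[ℝ] ℝ)) ξ
  have h2 : ((LinearMap.pi fun i => (φ i : V →ₗ[ℝ] ℝ)) ∘ ξ) =
      Matrix.toLin' (Matrix.of fun i j => φ i (ξ j)) ∘ fun i => Pi.single i 1 := by
    ext j i
    simp
  rw [h1, h2, ← image_parallelepiped, parallelepiped_single, Measure.addHaar_image_linearMap,
    LinearMap.det_toLin', wedge_apply, uIcc_of_le (by intro i; simp), Real.volume_Icc_pi]
  simp

lemma continuous_wedge_left (ξ : Fin q → V) :
    Continuous fun φ : Fin q → (V →L[ℝ] ℝ) => wedge φ ξ := by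
  simp only [wedge_apply]
  refine Continuous.matrix_det (continuous_matrix fun i j => ?_)
  exact (continuous_apply i).clm_apply continuous_const

variable [FiniteDimensional ℝ V]

/-- The image of `nu ⊗ volume` under the parametrization of the affine Grassmannian by systems
of equations. -/
def levelMeasure (nu : Measure (Fin q → (V →L[ℝ] ℝ))) : Measure (AffGr q V) :=
  ((nu.comap (Subtype.val : {φ : Fin q → (V →L[ℝ] ℝ) // LinearIndependent ℝ φ} → _)).prod
    volume).map ofEquations

instance : SecondCountableTopology (V →L[ℝ] ℝ) :=
  have : ProperSpace (V →L[ℝ] ℝ) := FiniteDimensional.proper_real _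
  secondCountable_of_proper

lemma measurable_ofEquations : Measurable (ofEquations (m := q) (V := V)) :=
  continuous_coinduced_rng.measurable

lemma measurableSet_linearIndependent :
    MeasurableSet {φ : Fin q → (V →L[ℝ] ℝ) | LinearIndependent ℝ φ} :=
  isOpen_setOfPred_linearIndependent.measurableSet

instance (nu : Measure (Fin q → (V →L[ℝ] ℝ))) [IsFiniteMeasure nu] : IsFiniteMeasure
    (nu.comap (Subtype.val : {φ : Fin q → (V →L[ℝ] ℝ) // LinearIndependent ℝ φ} → _)) :=
  ⟨by
    rw [comap_subtype_coe_apply measurableSet_linearIndependent]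
    exact measure_lt_top _ _⟩

/-- By Tonelli: for fixed forms `φ`, the right-hand sides `c` whose subspace meets `D` are the
points of `φ(D)`. -/
lemma levelMeasure_hitting (nu : Measure (Fin q → (V →L[ℝ] ℝ))) [IsFiniteMeasure nu] {D : Set V}
    (hD : IsCompact D) : levelMeasure nu (hitting q D) =
      ∫⁻ φ in {φ | LinearIndependent ℝ φ}, volume ((fun v i => φ i v) '' D) ∂nu := by
  have hm : MeasurableSet (hitting q D) := (isClosed_hitting hD).measurableSet
  rw [levelMeasure, Measure.map_apply measurable_ofEquations hm,
    Measure.prod_apply (measurable_ofEquations hm),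
    ← lintegral_subtype_comap measurableSet_linearIndependent]
  refine lintegral_congr fun φ => ?_
  congr 1
  ext c
  exact ofEquations_mem_hitting

lemma levelMeasure_parallelepiped (nu : Measure (Fin q → (V →L[ℝ] ℝ))) [IsFiniteMeasure nu]
    (ξ : Fin q → V) : levelMeasure nu (hitting q (parallelepiped ξ)) =
      ∫⁻ φ, ENNReal.ofReal |wedge φ ξ| ∂nu := by
  have hc : IsCompact (parallelepiped ξ) :=
    isCompact_Icc.image (by fun_prop)
  rw [levelMeasure_hitting nu hc]
  simp only [volume_image_parallelepiped]
  -- Dependent systems define no point of the Grassmannian, but their wedge product vanishes, so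
  -- they do not contribute to the integral either.
  refine setLIntegral_eq_of_support_subset ?_
  intro φ hφ
  apply linearIndependent_of_wedge_ne_zero φ ξ
  intro h
  simp [h] at hφ

/-- Translation by `v` keeps the forms and shifts `c` by `φ(v)`; Lebesgue measure on each slice is
invariant. -/
lemma levelMeasure_translate (nu : Measure (Fin q → (V →L[ℝ] ℝ))) [IsFiniteMeasure nu] (v : V)
    {B : Set (AffGr q V)} (hB : MeasurableSet B) :
    levelMeasure nu (AffGr.translate v ⁻¹' B) = levelMeasure nu B := by
  have hB' := (continuous_translate (q := q) v).measurable hB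
  rw [levelMeasure, Measure.map_apply measurable_ofEquations hB,
    Measure.map_apply measurable_ofEquations hB',
    Measure.prod_apply (measurable_ofEquations hB),
    Measure.prod_apply (measurable_ofEquations hB')]
  refine lintegral_congr fun φ => ?_
  rw [← measure_preimage_add volume (fun i => φ.1 i v) (Prod.mk φ ⁻¹' (ofEquations ⁻¹' B))]
  congr 1
  ext c
  simp only [mem_preimage]
  rw [translate_ofEquations]

/-- A compact set of subspaces is covered by the increasing open families of those meeting a ball,
so all its members meet one ball of some radius `r`. The image of that ball under `φ` lies in a cube
of side `2 C r`, which bounds the measure. -/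
lemma levelMeasure_finite (nu : Measure (Fin q → (V →L[ℝ] ℝ))) [IsFiniteMeasure nu] {C : ℝ}
    (hC : ∀ᵐ φ ∂nu, ∀ i, ‖φ i‖ ≤ C) : IsFiniteMeasureOnCompacts (levelMeasure nu) := by
  refine ⟨fun K hK => ?_⟩
  have hcover : K ⊆ ⋃ r : ℕ, hitting q (Metric.ball (0 : V) r) := by
    rintro H -
    obtain ⟨v, hv⟩ := H.2.1
    obtain ⟨r, hr⟩ := exists_nat_gt ‖v‖
    exact mem_iUnion.2 ⟨r, v, hv, by simpa using hr⟩
  obtain ⟨r, hr⟩ := hK.elim_directed_cover _ (fun r => isOpen_hitting Metric.isOpen_ball) hcover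
    (by
      refine Monotone.directed_le fun a b hab => ?_
      rintro H ⟨v, hv, hv'⟩
      exact ⟨v, hv, Metric.ball_subset_ball (by exact_mod_cast hab) hv'⟩)
  have hsub : hitting q (Metric.ball (0 : V) r) ⊆ hitting q (Metric.closedBall (0 : V) r) := by
    rintro H ⟨v, hv, hv'⟩
    exact ⟨v, hv, Metric.ball_subset_closedBall hv'⟩
  have : ProperSpace V := FiniteDimensional.proper_real _
  refine (measure_mono (hr.trans hsub)).trans_lt ?_
  rw [levelMeasure_hitting nu (isCompact_closedBall _ _)]
  have hbound : ∀ᵐ φ ∂nu, volume ((fun v i => φ i v) '' Metric.closedBall (0 : V) r) ≤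
      volume (Icc (fun _ : Fin q => -(C * r)) fun _ => C * r) := by
    filter_upwards [hC] with φ hφ
    refine measure_mono ?_
    rintro _ ⟨v, hv, rfl⟩
    have hv' : ‖v‖ ≤ r := by simpa using hv
    have h : ∀ i, |φ i v| ≤ C * r := fun i =>
      (φ i).le_of_opNorm_le_of_le (hφ i) hv'
    exact ⟨fun i => (abs_le.1 (h i)).1, fun i => (abs_le.1 (h i)).2⟩
  calc _ ≤ ∫⁻ φ, volume ((fun v i => φ i v) '' Metric.closedBall (0 : V) r) ∂nu :=
        setLIntegral_le_lintegral _ _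
    _ ≤ ∫⁻ _, volume (Icc (fun _ : Fin q => -(C * r)) fun _ => C * r) ∂nu :=
        lintegral_mono_ae hbound
    _ < ⊤ := by
        rw [lintegral_const]
        exact ENNReal.mul_lt_top isCompact_Icc.measure_lt_top (measure_lt_top _ _)

/-- A mixture of absolute values of decomposable forms is `χ` of a normal measure. -/
lemma exists_normalMeasure (nu : Measure (Fin q → (V →L[ℝ] ℝ))) [IsFiniteMeasure nu] {C : ℝ}
    (hC : ∀ᵐ φ ∂nu, ∀ i, ‖φ i‖ ≤ C) :
    ∃ μ : NormalMeasure q V, ∀ ξ, μ.chi ξ = ∫ φ, |wedge φ ξ| ∂nu := by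
  refine ⟨⟨levelMeasure nu, 0, levelMeasure_finite nu hC, inferInstance, ?_⟩, ?_⟩
  · intro v B hB
    simp [levelMeasure_translate nu v hB]
  · intro ξ
    simp only [NormalMeasure.chi, NormalMeasure.eval, Measure.real, Measure.coe_zero,
      Pi.zero_apply, ENNReal.toReal_zero, sub_zero]
    rw [levelMeasure_parallelepiped, integral_eq_lintegral_of_nonneg_ae]
    · exact Filter.Eventually.of_forall fun _ => abs_nonneg _
    · exact (continuous_wedge_left ξ).abs.aestronglyMeasurable

end LevelMeasure

/-! ### Mixtures of absolute values of decomposable forms -/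

section Mixture

variable {V : Type*} [NormedAddCommGroup V] [NormedSpace ℝ V] {q d : ℕ}

/-- `g` is an average of functions `|φ₁ ∧ … ∧ φ_q|` with uniformly bounded `φ_i`. -/
def IsMixture (g : (Fin q → V) → ℝ) : Prop :=
  ∃ (nu : Measure (Fin q → (V →L[ℝ] ℝ))) (C : ℝ), IsFiniteMeasure nu ∧
    (∀ᵐ φ ∂nu, ∀ i, ‖φ i‖ ≤ C) ∧ ∀ ξ, g ξ = ∫ φ, |wedge φ ξ| ∂nu

/-- The `v`-coefficient of the `i`-th form of a system dual to `e` whose wedge product has absolute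
value `D / D e`, recovered from `D` by polarization. -/
def polarCoeff (D : (Fin q → V) → ℝ) (e : Fin q → V) (i : Fin q) (v : V) : ℝ :=
  (D (Function.update e i (e i + v)) ^ 2 - D (Function.update e i (e i - v)) ^ 2) /
    (4 * D e ^ 2)

/-- Since `ψ` is dual to `e`, replacing `e i` by `v` in `D e` gives `D e * |ψ i v|`. The sign comes
from `ψ i (e i) = 1` and the identity `(1 + t)² - (1 - t)² = 4 t`. Thus `ψ` is an explicit rational
expression in values of `D`, and so measurable in any parameter in which `D` is. -/
lemma exists_polar_dual {D : (Fin q → V) → ℝ} {c : ℝ} {φ : Fin q → (V →L[ℝ] ℝ)}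
    (hD : ∀ ξ, D ξ = |c * wedge φ ξ|) {e : Fin q → V} (he : D e ≠ 0) :
    ∃ ψ : Fin q → (V →L[ℝ] ℝ), (∀ i v, polarCoeff D e i v = ψ i v) ∧
      (∀ i v, D (Function.update e i v) = D e * |ψ i v|) ∧ ∀ ξ, D ξ = D e * |wedge ψ ξ| := by
  have h0 : wedge φ e ≠ 0 := by
    intro h
    simp [hD, h] at he
  obtain ⟨ψ, hψ, hw⟩ := exists_dual_wedge φ e h0
  have h1 : ∀ ξ, D ξ = D e * |wedge ψ ξ| := by
    intro ξ
    rw [hD, hD, hw, ← mul_assoc, abs_mul]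
  have h2 : ∀ i v, D (Function.update e i v) = D e * |ψ i v| := by
    intro i v
    rw [h1, wedge_update_of_dual ψ e hψ]
  refine ⟨ψ, fun i v => ?_, h2, h1⟩
  have h3 : ψ i (e i) = 1 := by simp [hψ]
  rw [polarCoeff, h2, h2, mul_pow, mul_pow, sq_abs, sq_abs, map_add, map_sub, h3]
  field_simp
  ring

lemma continuous_abs_wedge (ξ : Fin q → V) :
    Continuous fun φ : Fin q → (V →L[ℝ] ℝ) => |wedge φ ξ| :=
  (continuous_wedge_left ξ).abs

lemma isMixture_zero : IsMixture (fun _ : Fin q → V => 0) :=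
  ⟨0, 0, inferInstance, by simp, by simp⟩

lemma eq_zero_of_basis {b : Module.Basis (Fin d) ℝ V} {D : (Fin q → V) → ℝ} {c : ℝ}
    {φ : Fin q → (V →L[ℝ] ℝ)} (hD : ∀ ξ, D ξ = |c * wedge φ ξ|)
    (h : ∀ I : Fin q → Fin d, D (b ∘ I) = 0) (ξ : Fin q → V) : D ξ = 0 := by
  have : c • wedge φ = 0 := by
    refine b.ext_alternating fun I _ => ?_
    have := h I
    rw [hD, abs_eq_zero] at this
    exact this
  rw [hD, abs_eq_zero]
  exact congrArg (fun f : V [⋀^Fin q]→ₗ[ℝ] ℝ => f ξ) this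

variable [FiniteDimensional ℝ V]

lemma integrable_abs_wedge (nu : Measure (Fin q → (V →L[ℝ] ℝ))) [IsFiniteMeasure nu] {C : ℝ}
    (hC : ∀ᵐ φ ∂nu, ∀ i, ‖φ i‖ ≤ C) (ξ : Fin q → V) :
    Integrable (fun φ => |wedge φ ξ|) nu := by
  have : ProperSpace (V →L[ℝ] ℝ) := FiniteDimensional.proper_real _
  obtain ⟨K, hK⟩ := (isCompact_closedBall (0 : Fin q → (V →L[ℝ] ℝ))
    |C|).exists_bound_of_continuousOn (continuous_abs_wedge ξ).continuousOn
  refine Integrable.of_bound (continuous_abs_wedge ξ).aestronglyMeasurable K ?_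
  filter_upwards [hC] with φ hφ
  refine hK φ ?_
  rw [mem_closedBall_zero_iff, pi_norm_le_iff_of_nonneg (abs_nonneg _)]
  exact fun i => (hφ i).trans (le_abs_self _)

lemma IsMixture.exists_normalMeasure {g : (Fin q → V) → ℝ} (hg : IsMixture g) :
    ∃ μ : NormalMeasure q V, ∀ ξ, g ξ = μ.chi ξ := by
  obtain ⟨nu, C, _, hC, h⟩ := hg
  obtain ⟨μ, hμ⟩ := NormalDensity.exists_normalMeasure nu hC
  exact ⟨μ, fun ξ => by rw [h, hμ]⟩

lemma IsMixture.add {g₁ g₂ : (Fin q → V) → ℝ} (h₁ : IsMixture g₁) (h₂ : IsMixture g₂) :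
    IsMixture (fun ξ => g₁ ξ + g₂ ξ) := by
  obtain ⟨nu₁, C₁, _, hC₁, h₁⟩ := h₁
  obtain ⟨nu₂, C₂, _, hC₂, h₂⟩ := h₂
  refine ⟨nu₁ + nu₂, max C₁ C₂, inferInstance, ?_, ?_⟩
  · rw [ae_add_measure_iff]
    constructor
    · filter_upwards [hC₁] with φ h i using (h i).trans (le_max_left _ _)
    · filter_upwards [hC₂] with φ h i using (h i).trans (le_max_right _ _)
  · intro ξ
    rw [integral_add_measure (integrable_abs_wedge nu₁ hC₁ ξ) (integrable_abs_wedge nu₂ hC₂ ξ),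
      ← h₁, ← h₂]

lemma IsMixture.sum {ι : Type*} (s : Finset ι) {g : ι → (Fin q → V) → ℝ}
    (h : ∀ i ∈ s, IsMixture (g i)) : IsMixture (fun ξ => ∑ i ∈ s, g i ξ) := by
  classical
  induction s using Finset.induction_on with
  | empty => simpa using isMixture_zero
  | insert a s ha ih =>
    simp only [Finset.sum_insert ha]
    exact (h a (Finset.mem_insert_self a s)).add
      (ih fun i hi => h i (Finset.mem_insert_of_mem hi))

/-- The system of forms with coefficients `polarCoeff D (b ∘ I)` in the basis dual to `b`. -/
def polarForm (b : Module.Basis (Fin d) ℝ V) (D : (Fin q → V) → ℝ) (I : Fin q → Fin d)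
    (i : Fin q) : V →L[ℝ] ℝ :=
  ∑ j, polarCoeff D (b ∘ I) i (b j) • (b.coord j).toContinuousLinearMap

lemma polarForm_eq {b : Module.Basis (Fin d) ℝ V} {D : (Fin q → V) → ℝ} {I : Fin q → Fin d}
    {i : Fin q} {ψ : V →L[ℝ] ℝ} (h : ∀ v, polarCoeff D (b ∘ I) i v = ψ v) :
    polarForm b D I i = ψ := by
  ext v
  simp only [polarForm, h, sum_apply, smul_apply,
    LinearMap.coe_toContinuousLinearMap', Module.Basis.coord_apply, smul_eq_mul]
  conv_rhs => rw [← b.sum_repr v, map_sum]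
  simp [mul_comm]

/-- An integral of a measurable family of absolute values of decomposable forms is a mixture, by
a measurable choice of factors. -/
lemma isMixture_integral {Ω : Type*} [MeasurableSpace Ω] (nu : Measure Ω)
    (D : Ω → (Fin q → V) → ℝ) (hm : ∀ ξ, Measurable fun u => D u ξ)
    (hi : ∀ ξ, Integrable (fun u => D u ξ) nu)
    (hD : ∀ u, ∃ (c : ℝ) (φ : Fin q → (V →L[ℝ] ℝ)), ∀ ξ, D u ξ = |c * wedge φ ξ|) :
    IsMixture (fun ξ => ∫ u, D u ξ ∂nu) := by
  classical
  have hnn : ∀ u ξ, 0 ≤ D u ξ := by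
    intro u ξ
    obtain ⟨c, φ, h⟩ := hD u
    rw [h]
    exact abs_nonneg _
  let b := Module.finBasis ℝ V
  let e : (Fin q → Fin (Module.finrank ℝ V)) → Fin q → V := fun I => b ∘ I
  -- `A I` consists of the parameters at which the basis vectors with indices `I` maximize a nonzero
  -- density. These sets may overlap; the weights `w` share each parameter equally among the sets
  -- containing it.
  let A : (Fin q → Fin (Module.finrank ℝ V)) → Set Ω := fun I =>
    {u | (∀ J, D u (e J) ≤ D u (e I)) ∧ D u (e I) ≠ 0}
  have hA : ∀ I, MeasurableSet (A I) := by
    intro I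
    have : A I = (⋂ J, {u | D u (e J) ≤ D u (e I)}) ∩ (fun u => D u (e I)) ⁻¹' {0}ᶜ := by
      ext u; simp [A]
    rw [this]
    exact (MeasurableSet.iInter fun J => measurableSet_le (hm _) (hm _)).inter
      (hm (e I) (measurableSet_singleton (0 : ℝ)).compl)
  let w : (Fin q → Fin (Module.finrank ℝ V)) → Ω → ℝ := fun I u =>
    (A I).indicator 1 u / ∑ J, (A J).indicator 1 u
  have hw : ∀ I, Measurable (w I) := fun I =>
    (measurable_one.indicator (hA I)).div
      (Finset.measurable_sum _ fun J _ => measurable_one.indicator (hA J))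
  have hind : ∀ I u, (0 : ℝ) ≤ (A I).indicator 1 u := fun I u =>
    indicator_nonneg (fun _ _ => zero_le_one) u
  have hw0 : ∀ I u, 0 ≤ w I u := fun I u =>
    div_nonneg (hind I u) (Finset.sum_nonneg fun J _ => hind J u)
  have hw1 : ∀ I u, w I u ≤ 1 := fun I u =>
    div_le_one_of_le₀ (Finset.single_le_sum (fun J _ => hind J u) (Finset.mem_univ I))
      (Finset.sum_nonneg fun J _ => hind J u)
  have hwA : ∀ I u, u ∉ A I → w I u = 0 := by
    intro I u hu
    simp [w, hu]
  have hwsum : ∀ u ξ, ∑ I, w I u * D u ξ = D u ξ := by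
    -- If `D u` vanishes on all tuples of basis vectors it is zero; otherwise a maximizing `I`
    -- exists and the weights add up to 1.
    intro u ξ
    rw [← Finset.sum_mul]
    by_cases h : ∀ I, D u (e I) = 0
    · obtain ⟨c, φ, hφ⟩ := hD u
      rw [eq_zero_of_basis hφ h, mul_zero]
    · push Not at h
      obtain ⟨I₀, hI₀⟩ := h
      obtain ⟨I, -, hI⟩ := Finset.exists_max_image Finset.univ (fun I => D u (e I)) ⟨I₀, by simp⟩
      have hIA : u ∈ A I := by
        refine ⟨fun J => hI J (Finset.mem_univ J), fun h0 => hI₀ (le_antisymm ?_ (hnn _ _))⟩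
        exact h0 ▸ hI I₀ (Finset.mem_univ I₀)
      have hpos : (0 : ℝ) < ∑ J, (A J).indicator 1 u := by
        refine lt_of_lt_of_le ?_
          (Finset.single_le_sum (fun J _ => hind J u) (Finset.mem_univ I))
        simp [hIA]
      have : ∑ I, w I u = 1 := by
        simp only [w]
        rw [← Finset.sum_div, div_self hpos.ne']
      rw [this, one_mul]
  have hint : ∀ I ξ, Integrable (fun u => w I u * D u ξ) nu := by
    intro I ξ
    refine (hi ξ).bdd_mul (hw I).aestronglyMeasurable (c := 1) (Filter.Eventually.of_forall ?_)
    intro u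
    rw [Real.norm_eq_abs, abs_of_nonneg (hw0 I u)]
    exact hw1 I u
  have hsum : (fun ξ => ∫ u, D u ξ ∂nu) = fun ξ => ∑ I, ∫ u, w I u * D u ξ ∂nu := by
    ext ξ
    rw [← integral_finsetSum _ fun I _ => hint I ξ]
    simp only [hwsum]
  rw [hsum]
  refine IsMixture.sum _ fun I _ => ?_
  let h : Ω → ℝ := fun u => w I u * D u (e I)
  have hh : Measurable h := (hw I).mul (hm _)
  have hh0 : ∀ u, 0 ≤ h u := fun u => mul_nonneg (hw0 I u) (hnn _ _)
  let Ψ : Ω → Fin q → (V →L[ℝ] ℝ) := fun u i => polarForm b (D u) I i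
  have hΨ : Measurable Ψ := by
    refine measurable_pi_lambda _ fun i => ?_
    refine Finset.measurable_sum _ fun j _ => ?_
    refine Measurable.smul_const ?_ _
    exact (((hm _).pow_const 2).sub ((hm _).pow_const 2)).div (((hm _).pow_const 2).const_mul 4)
  have hΨA : ∀ u ∈ A I, (∀ ξ, D u ξ = D u (e I) * |wedge (Ψ u) ξ|) ∧
      ∀ i, ‖Ψ u i‖ ≤ ∑ j, ‖(b.coord j).toContinuousLinearMap‖ := by
    intro u hu
    obtain ⟨c, φ, hφ⟩ := hD u
    obtain ⟨ψ, h1, h2, h3⟩ := exists_polar_dual hφ hu.2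
    have hψ : Ψ u = ψ := funext fun i => polarForm_eq (h1 i)
    refine ⟨fun ξ => by rw [hψ]; exact h3 ξ, fun i => ?_⟩
    refine (norm_sum_le _ _).trans (Finset.sum_le_sum fun j _ => ?_)
    rw [norm_smul]
    refine mul_le_of_le_one_left (norm_nonneg _) ?_
    have hpos : 0 < D u (e I) := lt_of_le_of_ne (hnn _ _) (Ne.symm hu.2)
    -- Maximality, compared with the tuple in which `b j` replaces the `i`-th vector, says `D e * |ψ
    -- i (b j)| ≤ D e`, so the coefficients of `ψ` are at most 1 in absolute value.
    have h4 := hu.1 (Function.update I i j)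
    have h5 : e (Function.update I i j) = Function.update (e I) i (b j) :=
      Function.comp_update b I i j
    rw [h5, h2] at h4
    rw [h1 i, Real.norm_eq_abs]
    exact le_of_mul_le_mul_left (by linarith) hpos
  have hfin : IsFiniteMeasure (nu.withDensity fun u => ENNReal.ofReal (h u)) :=
    isFiniteMeasure_withDensity_ofReal (hint I (e I)).2
  -- On `A I` one has `w I * D u ξ = h u * |wedge (Ψ u) ξ|`: the scalar `h` becomes the density of
  -- the measure, and the forms are transported by `Ψ`.
  refine ⟨(nu.withDensity fun u => ENNReal.ofReal (h u)).map Ψ,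
    ∑ j, ‖(b.coord j).toContinuousLinearMap‖, inferInstance, ?_, fun ξ => ?_⟩
  · refine (ae_map_iff hΨ.aemeasurable ?_).2 ?_
    · have : {φ : Fin q → (V →L[ℝ] ℝ) | ∀ i, ‖φ i‖ ≤ ∑ j, ‖(b.coord j).toContinuousLinearMap‖} =
        ⋂ i, {φ | ‖φ i‖ ≤ ∑ j, ‖(b.coord j).toContinuousLinearMap‖} := by ext; simp
      rw [this]
      exact (isClosed_iInter fun i =>
        isClosed_le (continuous_apply i).norm continuous_const).measurableSet
    · rw [ae_withDensity_iff hh.ennreal_ofReal]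
      refine Filter.Eventually.of_forall fun u hu => ?_
      by_cases huA : u ∈ A I
      · exact (hΨA u huA).2
      · simp [h, hwA I u huA] at hu
  · rw [integral_map hΨ.aemeasurable (continuous_abs_wedge ξ).aestronglyMeasurable,
      integral_withDensity_eq_integral_toReal_smul hh.ennreal_ofReal
        (Filter.Eventually.of_forall fun _ => ENNReal.ofReal_lt_top)]
    refine integral_congr_ae (Filter.Eventually.of_forall fun u => ?_)
    simp only [ENNReal.toReal_ofReal (hh0 u), smul_eq_mul, h]
    by_cases huA : u ∈ A I
    · rw [mul_assoc, ← (hΨA u huA).1]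
    · simp [hwA I u huA]

end Mixture

/-! ### Continuity of a field along a smooth map -/

section Field

variable {n m : ℕ} {X : Type*} [TopologicalSpace X] [ChartedSpace (EuclideanSpace ℝ (Fin n)) X]
  [IsManifold (𝓡 n) ∞ X] {E : Type*} [NormedAddCommGroup E] [NormedSpace ℝ E]

/-- By the chain rule, the derivative of `σ` read in the chart is the trivialized vector `dσ ζ`.
This translates the continuity condition on fields, stated in trivializations, into one about
differentials. -/
lemma symm_trivializationAt_fderiv {σ : E → X} {e : E} {x₀ : X}
    (hσ : MDifferentiableAt 𝓘(ℝ, E) (𝓡 n) σ e)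
    (hx : σ e ∈ (chartAt (EuclideanSpace ℝ (Fin n)) x₀).source) (ζ : E) :
    (trivializationAt (EuclideanSpace ℝ (Fin n)) (TangentSpace (𝓡 n)) x₀).symm (σ e)
      (fderiv ℝ (extChartAt (𝓡 n) x₀ ∘ σ) e ζ) = mfderiv 𝓘(ℝ, E) (𝓡 n) σ e ζ := by
  have : IsManifold (𝓡 n) 1 X := IsManifold.of_le (n := ∞) (by norm_num)
  have hd : MDifferentiableAt (𝓡 n) 𝓘(ℝ, EuclideanSpace ℝ (Fin n)) (extChartAt (𝓡 n) x₀) (σ e) :=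
    mdifferentiableAt_extChartAt hx
  have h1 := mfderiv_comp e hd hσ
  rw [mfderiv_eq_fderiv, ← TangentBundle.continuousLinearMapAt_trivializationAt hx] at h1
  rw [h1]
  have hb : σ e ∈ (trivializationAt (EuclideanSpace ℝ (Fin n)) (TangentSpace (𝓡 n)) x₀).baseSet :=
    hx
  have h2 := (trivializationAt (EuclideanSpace ℝ (Fin n)) (TangentSpace (𝓡 n))
    x₀).symmL_continuousLinearMapAt (R := ℝ) hb (mfderiv 𝓘(ℝ, E) (𝓡 n) σ e ζ)
  rw [Trivialization.symmL_apply _ hb] at h2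
  exact h2

/-- A continuous field evaluated on the images of vectors under the differential of a smooth map
is continuous. -/
lemma IsContinuousField.continuousOn_comp_mfderiv {δ : TangentFunction n m X}
    (hδ : IsContinuousField δ) {σ : E → X} {Ω : Set E} (hΩ : IsOpen Ω)
    (hσ : ContMDiffOn 𝓘(ℝ, E) (𝓡 n) ∞ σ Ω) :
    ContinuousOn (fun z : E × (Fin m → E) =>
      δ (σ z.1) fun i => mfderiv 𝓘(ℝ, E) (𝓡 n) σ z.1 (z.2 i)) (Ω ×ˢ univ) := by
  rintro ⟨e₀, ζ₀⟩ ⟨he₀, -⟩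
  refine ContinuousAt.continuousWithinAt ?_
  let g : E → EuclideanSpace ℝ (Fin n) := extChartAt (𝓡 n) (σ e₀) ∘ σ
  let Ω' : Set E := Ω ∩ σ ⁻¹' (chartAt (EuclideanSpace ℝ (Fin n)) (σ e₀)).source
  have hΩ' : IsOpen Ω' := hσ.continuousOn.isOpen_inter_preimage hΩ (chartAt _ _).open_source
  have he₀' : e₀ ∈ Ω' := ⟨he₀, mem_chart_source _ _⟩
  have hg : ContDiffOn ℝ ∞ g Ω' := by
    rw [← contMDiffOn_iff_contDiffOn]
    exact (contMDiffOn_extChartAt (n := ∞)).comp (hσ.mono inter_subset_left) fun e he => he.2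
  have hg' : ContinuousOn (fderiv ℝ g) Ω' := hg.continuousOn_fderiv_of_isOpen hΩ' (by norm_num)
  let F : E × (Fin m → E) → X × (Fin m → EuclideanSpace ℝ (Fin n)) :=
    fun z => (σ z.1, fun i => fderiv ℝ g z.1 (z.2 i))
  have hF : ContinuousAt F (e₀, ζ₀) := by
    refine ContinuousAt.prodMk ?_ ?_
    · exact ContinuousAt.comp (g := σ) (hσ.continuousOn.continuousAt (hΩ.mem_nhds he₀))
        continuousAt_fst
    · refine continuousAt_pi.2 fun i => ?_
      refine ContinuousAt.clm_apply ?_ (by fun_prop)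
      exact ContinuousAt.comp (g := fderiv ℝ g) (hg'.continuousAt (hΩ'.mem_nhds he₀'))
        continuousAt_fst
  have hb : (trivializationAt (EuclideanSpace ℝ (Fin n)) (TangentSpace (𝓡 n)) (σ e₀)).baseSet ×ˢ
      (univ : Set (Fin m → EuclideanSpace ℝ (Fin n))) ∈ 𝓝 (F (e₀, ζ₀)) :=
    prod_mem_nhds ((Trivialization.open_baseSet _).mem_nhds (mem_baseSet_trivializationAt _ _ _))
      Filter.univ_mem
  have hc := ((hδ (σ e₀)).continuousAt hb).comp hF
  refine hc.congr ?_
  have hnhds : Ω' ×ˢ univ ∈ 𝓝 (e₀, ζ₀) := prod_mem_nhds (hΩ'.mem_nhds he₀') Filter.univ_mem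
  filter_upwards [hnhds] with z hz
  have hd : MDifferentiableAt 𝓘(ℝ, E) (𝓡 n) σ z.1 :=
    (hσ.contMDiffAt (hΩ.mem_nhds hz.1.1)).mdifferentiableAt (by norm_num)
  refine congrArg (δ (σ z.1)) (funext fun i => ?_)
  exact symm_trivializationAt_fderiv hd hz.1.2 (z.2 i)

end Field

/-! ### The weights in the definition of the integral -/

section Weights

variable (k : ℕ) (M : Type*) [TopologicalSpace M] [ChartedSpace (EuclideanSpace ℝ (Fin k)) M]
  [IsManifold (𝓡 k) ∞ M] [CompactSpace M] [T2Space M]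

lemma exists_finset_chartPartition :
    ∃ s : Finset M, ∀ i ∉ s, ∀ x, chartPartition k M i x = 0 := by
  have h := (chartPartition k M).locallyFinite.finite_nonempty_of_compact
  refine ⟨h.toFinset, fun i hi x => ?_⟩
  by_contra hx
  exact hi (h.mem_toFinset.2 ⟨x, hx⟩)

variable {k M}

lemma sum_chartPartition {s : Finset M} (hs : ∀ i ∉ s, ∀ x, chartPartition k M i x = 0) (x : M) :
    ∑ i ∈ s, chartPartition k M i x = 1 := by
  rw [← (chartPartition k M).sum_eq_one (mem_univ x)]
  refine (finsum_eq_sum_of_support_subset _ fun i hi => ?_).symm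
  by_contra his
  exact hi (hs i his x)

lemma integral_eq_sum {s : Finset M} (hs : ∀ i ∉ s, ∀ x, chartPartition k M i x = 0)
    (ρ : TangentFunction k k M) :
    integral ρ = ∑ i ∈ s, ∫ u in (extChartAt (𝓡 k) i).target,
      chartPartition k M i ((extChartAt (𝓡 k) i).symm u) *
        ρ ((extChartAt (𝓡 k) i).symm u) (coordVectors i u) := by
  refine finsum_eq_sum_of_support_subset _ fun i hi => ?_
  by_contra his
  refine hi ?_
  simp [hs i his]

lemma chartPartition_eq_zero {i x : M}
    (hx : x ∉ (chartAt (EuclideanSpace ℝ (Fin k)) i).source) : chartPartition k M i x = 0 := by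
  by_contra h
  exact hx (chartPartition_isSubordinate k M i (subset_tsupport _ h))

/-- The image of the support of a weight in the chart. -/
def weightSupport (i : M) : Set (EuclideanSpace ℝ (Fin k)) :=
  extChartAt (𝓡 k) i '' tsupport (chartPartition k M i)

lemma isCompact_weightSupport (i : M) : IsCompact (weightSupport (k := k) i) := by
  refine (isClosed_tsupport _).isCompact.image_of_continuousOn ?_
  refine (continuousOn_extChartAt i).mono ?_
  rw [extChartAt_source]
  exact chartPartition_isSubordinate k M i

lemma weightSupport_subset (i : M) :
    weightSupport (k := k) i ⊆ (extChartAt (𝓡 k) i).target := by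
  rintro _ ⟨x, hx, rfl⟩
  refine (extChartAt (𝓡 k) i).map_source ?_
  rw [extChartAt_source]
  exact chartPartition_isSubordinate k M i hx

lemma weight_eq_zero {i : M} {u : EuclideanSpace ℝ (Fin k)}
    (hu : u ∈ (extChartAt (𝓡 k) i).target) (hu' : u ∉ weightSupport (k := k) i) :
    chartPartition k M i ((extChartAt (𝓡 k) i).symm u) = 0 := by
  by_contra h
  exact hu' ⟨_, subset_tsupport _ h, (extChartAt (𝓡 k) i).right_inv hu⟩

lemma continuousOn_weight (i : M) : ContinuousOn
    (fun u => chartPartition k M i ((extChartAt (𝓡 k) i).symm u)) (extChartAt (𝓡 k) i).target :=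
  (chartPartition k M i).contMDiff.continuous.comp_continuousOn (continuousOn_extChartAt_symm i)

lemma integrableOn_weight_mul (i : M) {G : EuclideanSpace ℝ (Fin k) → ℝ}
    (hG : ContinuousOn G (extChartAt (𝓡 k) i).target) :
    IntegrableOn (fun u => chartPartition k M i ((extChartAt (𝓡 k) i).symm u) * G u)
      (extChartAt (𝓡 k) i).target := by
  have h1 : IntegrableOn (fun u => chartPartition k M i ((extChartAt (𝓡 k) i).symm u) * G u)
      (weightSupport (k := k) i) :=
    (((continuousOn_weight i).mul hG).mono (weightSupport_subset i)).integrableOn_compact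
      (isCompact_weightSupport i)
  refine h1.of_forall_sdiff_eq_zero (isOpen_extChartAt_target i).measurableSet ?_
  rintro u ⟨hu, hu'⟩
  rw [weight_eq_zero hu hu', zero_mul]

lemma indicator_weight_mul_eq_zero {i : M} {u : EuclideanSpace ℝ (Fin k)}
    (hu : u ∉ weightSupport (k := k) i) (G : EuclideanSpace ℝ (Fin k) → ℝ) :
    (extChartAt (𝓡 k) i).target.indicator
      (fun u => chartPartition k M i ((extChartAt (𝓡 k) i).symm u) * G u) u = 0 := by
  by_cases hu' : u ∈ (extChartAt (𝓡 k) i).target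
  · rw [indicator_of_mem hu', weight_eq_zero hu' hu, zero_mul]
  · exact indicator_of_notMem hu' _

end Weights

/-! ### Invariance of the integral under diffeomorphisms -/

section ChangeOfVariables

lemma TangentFunction.congr {n m : ℕ} {X : Type*} [TopologicalSpace X]
    [ChartedSpace (EuclideanSpace ℝ (Fin n)) X] (ρ : TangentFunction n m X) {x x' : X}
    (hx : x = x') {f f' : Fin m → EuclideanSpace ℝ (Fin n)} (hf : ∀ i, f i = f' i) :
    ρ x f = ρ x' f' := by
  subst hx
  rw [funext hf]

variable (k : ℕ) {M : Type*} [TopologicalSpace M] [ChartedSpace (EuclideanSpace ℝ (Fin k)) M]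
  {N : Type*} [TopologicalSpace N] [ChartedSpace (EuclideanSpace ℝ (Fin k)) N]

/-- The domain of the coordinate expression of `Φ`. -/
def coordDomain (Φ : M → N) (i : M) (j : N) : Set (EuclideanSpace ℝ (Fin k)) :=
  (extChartAt (𝓡 k) i).target ∩
    (fun u => Φ ((extChartAt (𝓡 k) i).symm u)) ⁻¹' (extChartAt (𝓡 k) j).source

/-- The coordinate expression of `Φ`. -/
def coordMap (Φ : M → N) (i : M) (j : N) (u : EuclideanSpace ℝ (Fin k)) :
    EuclideanSpace ℝ (Fin k) :=
  extChartAt (𝓡 k) j (Φ ((extChartAt (𝓡 k) i).symm u))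

variable {k}

lemma isOpen_coordDomain {Φ : M → N} (hΦ : Continuous Φ) (i : M) (j : N) :
    IsOpen (coordDomain k Φ i j) :=
  (hΦ.comp_continuousOn (continuousOn_extChartAt_symm i)).isOpen_inter_preimage
    (isOpen_extChartAt_target i) (isOpen_extChartAt_source j)

lemma coordMap_mem_target {Φ : M → N} {i : M} {j : N} {u : EuclideanSpace ℝ (Fin k)}
    (hu : u ∈ coordDomain k Φ i j) : coordMap k Φ i j u ∈ (extChartAt (𝓡 k) j).target :=
  (extChartAt (𝓡 k) j).map_source hu.2

lemma symm_coordMap {Φ : M → N} {i : M} {j : N} {u : EuclideanSpace ℝ (Fin k)}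
    (hu : u ∈ coordDomain k Φ i j) : (extChartAt (𝓡 k) j).symm (coordMap k Φ i j u) =
      Φ ((extChartAt (𝓡 k) i).symm u) :=
  (extChartAt (𝓡 k) j).left_inv hu.2

lemma image_coordMap {Φ : M → N} {Ψ : N → M} (h₁ : Function.LeftInverse Ψ Φ)
    (h₂ : Function.RightInverse Ψ Φ) (i : M) (j : N) :
    coordMap k Φ i j '' coordDomain k Φ i j = coordDomain k Ψ j i := by
  ext v
  constructor
  · rintro ⟨u, hu, rfl⟩
    refine ⟨coordMap_mem_target hu, ?_⟩
    rw [mem_preimage, symm_coordMap hu, h₁]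
    exact (extChartAt (𝓡 k) i).map_target hu.1
  · intro hv
    have hu : coordMap k Ψ j i v ∈ coordDomain k Φ i j := by
      refine ⟨coordMap_mem_target hv, ?_⟩
      rw [mem_preimage, symm_coordMap hv, h₂]
      exact (extChartAt (𝓡 k) j).map_target hv.1
    refine ⟨_, hu, ?_⟩
    rw [coordMap, symm_coordMap hv, h₂]
    exact (extChartAt (𝓡 k) j).right_inv hv.1

lemma injOn_coordMap {Φ : M → N} {Ψ : N → M} (h₁ : Function.LeftInverse Ψ Φ) (i : M) (j : N) :
    InjOn (coordMap k Φ i j) (coordDomain k Φ i j) := by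
  intro u hu u' hu' h
  have h2 := (symm_coordMap hu).symm.trans
    ((congrArg (extChartAt (𝓡 k) j).symm h).trans (symm_coordMap hu'))
  exact (extChartAt (𝓡 k) i).symm.injOn hu.1 hu'.1 (h₁.injective h2)

variable [IsManifold (𝓡 k) ∞ M] [IsManifold (𝓡 k) ∞ N]

lemma mdifferentiableAt_extChartAt_symm {i : M} {u : EuclideanSpace ℝ (Fin k)}
    (hu : u ∈ (extChartAt (𝓡 k) i).target) :
    MDifferentiableAt 𝓘(ℝ, EuclideanSpace ℝ (Fin k)) (𝓡 k) (extChartAt (𝓡 k) i).symm u :=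
  ((contMDiffOn_extChartAt_symm (n := ∞) i).contMDiffAt
    ((isOpen_extChartAt_target i).mem_nhds hu)).mdifferentiableAt (by norm_num)

lemma contDiffOn_coordMap {Φ : M → N} (hΦ : ContMDiff (𝓡 k) (𝓡 k) ∞ Φ) (i : M) (j : N) :
    ContDiffOn ℝ ∞ (coordMap k Φ i j) (coordDomain k Φ i j) := by
  rw [← contMDiffOn_iff_contDiffOn]
  refine (contMDiffOn_extChartAt (n := ∞)).comp (t := (chartAt _ j).source)
    (hΦ.comp_contMDiffOn ((contMDiffOn_extChartAt_symm (n := ∞) i).mono inter_subset_left)) ?_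
  intro u hu
  simpa using hu.2

lemma hasFDerivAt_coordMap {Φ : M → N} (hΦ : ContMDiff (𝓡 k) (𝓡 k) ∞ Φ) {i : M} {j : N}
    {u : EuclideanSpace ℝ (Fin k)} (hu : u ∈ coordDomain k Φ i j) :
    HasFDerivAt (coordMap k Φ i j) (fderiv ℝ (coordMap k Φ i j) u) u :=
  (((contDiffOn_coordMap hΦ i j).contDiffAt ((isOpen_coordDomain hΦ.continuous i j).mem_nhds
    hu)).differentiableAt (by norm_num)).hasFDerivAt

/-- Both sides are derivatives, by the chain rule, of two expressions for the same map near `u`. -/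
lemma mfderiv_symm_fderiv_coordMap {Φ : M → N} (hΦ : ContMDiff (𝓡 k) (𝓡 k) ∞ Φ) {i : M} {j : N}
    {u : EuclideanSpace ℝ (Fin k)} (hu : u ∈ coordDomain k Φ i j) (w : EuclideanSpace ℝ (Fin k)) :
    @Eq (EuclideanSpace ℝ (Fin k))
      (mfderiv (𝓡 k) (𝓡 k) Φ ((extChartAt (𝓡 k) i).symm u)
        (mfderiv (𝓡 k) (𝓡 k) (extChartAt (𝓡 k) i).symm u w))
      (mfderiv (𝓡 k) (𝓡 k) (extChartAt (𝓡 k) j).symm (coordMap k Φ i j u)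
        (fderiv ℝ (coordMap k Φ i j) u w)) := by
  have h1 : HasMFDerivAt (𝓡 k) (𝓡 k) (Φ ∘ (extChartAt (𝓡 k) i).symm) u
      ((mfderiv (𝓡 k) (𝓡 k) Φ ((extChartAt (𝓡 k) i).symm u)).comp
        (mfderiv (𝓡 k) (𝓡 k) (extChartAt (𝓡 k) i).symm u)) :=
    HasMFDerivAt.comp u ((hΦ _).mdifferentiableAt (by norm_num)).hasMFDerivAt
      (mdifferentiableAt_extChartAt_symm hu.1).hasMFDerivAt
  have h2 : HasMFDerivAt (𝓡 k) (𝓡 k) ((extChartAt (𝓡 k) j).symm ∘ coordMap k Φ i j) u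
      ((mfderiv (𝓡 k) (𝓡 k) (extChartAt (𝓡 k) j).symm (coordMap k Φ i j u)).comp
        (fderiv ℝ (coordMap k Φ i j) u)) :=
    HasMFDerivAt.comp u (mdifferentiableAt_extChartAt_symm (coordMap_mem_target hu)).hasMFDerivAt
      (hasFDerivAt_coordMap hΦ hu).hasMFDerivAt
  have h3 : (extChartAt (𝓡 k) j).symm ∘ coordMap k Φ i j =ᶠ[𝓝 u] Φ ∘ (extChartAt (𝓡 k) i).symm := by
    filter_upwards [(isOpen_coordDomain hΦ.continuous i j).mem_nhds hu] with v hv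
    exact symm_coordMap hv
  have h4 := hasMFDerivAt_unique h1 (h2.congr_of_eventuallyEq h3.symm)
  exact congrArg (fun L : EuclideanSpace ℝ (Fin k) →L[ℝ] EuclideanSpace ℝ (Fin k) => L w) h4

/-- Transformation of the coordinate expression of a density. -/
lemma density_coordMap {Φ : M → N} (hΦ : ContMDiff (𝓡 k) (𝓡 k) ∞ Φ) {ρ : TangentFunction k k N}
    (hρ : ∀ x (A : Matrix (Fin k) (Fin k) ℝ) (f : Fin k → TangentSpace (𝓡 k) x),
      ρ x (fun b => ∑ a, A a b • f a) = |A.det| * ρ x f) {i : M} {j : N}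
    {u : EuclideanSpace ℝ (Fin k)} (hu : u ∈ coordDomain k Φ i j) :
    ρ (Φ ((extChartAt (𝓡 k) i).symm u))
        (fun a => mfderiv (𝓡 k) (𝓡 k) Φ ((extChartAt (𝓡 k) i).symm u) (coordVectors i u a)) =
      |(fderiv ℝ (coordMap k Φ i j) u).det| *
        ρ ((extChartAt (𝓡 k) j).symm (coordMap k Φ i j u))
          (coordVectors j (coordMap k Φ i j u)) := by
  let b := (EuclideanSpace.basisFun (Fin k) ℝ).toBasis
  let A : Matrix (Fin k) (Fin k) ℝ :=
    LinearMap.toMatrix b b (fderiv ℝ (coordMap k Φ i j) u : _ →ₗ[ℝ] _)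
  have hA : A.det = (fderiv ℝ (coordMap k Φ i j) u).det := LinearMap.det_toMatrix b _
  rw [← hA, ← hρ]
  refine ρ.congr (symm_coordMap hu).symm fun c => ?_
  refine (mfderiv_symm_fderiv_coordMap hΦ hu _).trans ?_
  have hsum : fderiv ℝ (coordMap k Φ i j) u (EuclideanSpace.single c 1) =
      ∑ a, A a c • EuclideanSpace.single a (1 : ℝ) := by
    ext a
    simp [A, LinearMap.toMatrix_apply, b, Pi.single_apply]
  rw [hsum]
  exact (map_sum _ _ _).trans (Finset.sum_congr rfl fun a _ => map_smul _ _ _)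

variable [CompactSpace M] [T2Space M] [CompactSpace N] [T2Space N]

/-- Change of variables for the part of a density supported in a chart of `M` and in a chart of
`N`. -/
lemma setIntegral_coordMap {Φ : M → N} {Ψ : N → M} (hΦ : ContMDiff (𝓡 k) (𝓡 k) ∞ Φ)
    (h₁ : Function.LeftInverse Ψ Φ) (h₂ : Function.RightInverse Ψ Φ)
    {ρ : TangentFunction k k N}
    (hρ : ∀ x (A : Matrix (Fin k) (Fin k) ℝ) (f : Fin k → TangentSpace (𝓡 k) x),
      ρ x (fun b => ∑ a, A a b • f a) = |A.det| * ρ x f) (i : M) (j : N) :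
    ∫ v in (extChartAt (𝓡 k) j).target, chartPartition k M i (Ψ ((extChartAt (𝓡 k) j).symm v)) *
        (chartPartition k N j ((extChartAt (𝓡 k) j).symm v) *
          ρ ((extChartAt (𝓡 k) j).symm v) (coordVectors j v)) =
      ∫ u in (extChartAt (𝓡 k) i).target, chartPartition k N j (Φ ((extChartAt (𝓡 k) i).symm u)) *
        (chartPartition k M i ((extChartAt (𝓡 k) i).symm u) *
          ρ (Φ ((extChartAt (𝓡 k) i).symm u)) (fun a =>
            mfderiv (𝓡 k) (𝓡 k) Φ ((extChartAt (𝓡 k) i).symm u) (coordVectors i u a))) := by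
  have hS : IsOpen (coordDomain k Φ i j) := isOpen_coordDomain hΦ.continuous i j
  -- The weights vanish outside their charts, so both integrals reduce to the domains where the
  -- coordinate expressions are defined, and `coordMap` maps one domain bijectively onto the other.
  rw [setIntegral_eq_of_subset_of_forall_sdiff_eq_zero
      (isOpen_extChartAt_target j).measurableSet (s := coordDomain k Ψ j i) inter_subset_left,
    setIntegral_eq_of_subset_of_forall_sdiff_eq_zero
      (isOpen_extChartAt_target i).measurableSet (s := coordDomain k Φ i j) inter_subset_left,
    ← image_coordMap h₁ h₂,
    integral_image_eq_integral_abs_det_fderiv_smul volume hS.measurableSet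
      (fun u hu => (hasFDerivAt_coordMap hΦ hu).hasFDerivWithinAt) (injOn_coordMap h₁ i j)]
  · refine setIntegral_congr_fun hS.measurableSet fun u hu => ?_
    simp only [density_coordMap hΦ hρ hu, smul_eq_mul]
    rw [symm_coordMap hu, h₁]
    ring
  · rintro u ⟨hu, hu'⟩
    rw [chartPartition_eq_zero (i := j), zero_mul]
    intro h
    exact hu' ⟨hu, by simpa using h⟩
  · rintro u ⟨hu, hu'⟩
    rw [chartPartition_eq_zero (i := i), zero_mul]
    intro h
    exact hu' ⟨hu, by simpa using h⟩

/-- The integral of a density is invariant under diffeomorphisms. -/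
theorem integral_comp_diffeo {Φ : M → N} {Ψ : N → M} (hΦ : ContMDiff (𝓡 k) (𝓡 k) ∞ Φ)
    (hΨ : Continuous Ψ) (h₁ : Function.LeftInverse Ψ Φ) (h₂ : Function.RightInverse Ψ Φ)
    {ρ : TangentFunction k k N}
    (hρ : ∀ x (A : Matrix (Fin k) (Fin k) ℝ) (f : Fin k → TangentSpace (𝓡 k) x),
      ρ x (fun b => ∑ a, A a b • f a) = |A.det| * ρ x f)
    (hN : ∀ j, ContinuousOn (fun v => ρ ((extChartAt (𝓡 k) j).symm v) (coordVectors j v))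
      (extChartAt (𝓡 k) j).target)
    (hM : ∀ i, ContinuousOn (fun u => ρ (Φ ((extChartAt (𝓡 k) i).symm u)) (fun a =>
            mfderiv (𝓡 k) (𝓡 k) Φ ((extChartAt (𝓡 k) i).symm u) (coordVectors i u a)))
      (extChartAt (𝓡 k) i).target) :
    integral ρ = integral (fun z f => ρ (Φ z) fun a => mfderiv (𝓡 k) (𝓡 k) Φ z (f a) :
      TangentFunction k k M) := by
  obtain ⟨s, hs⟩ := exists_finset_chartPartition k M
  obtain ⟨t, ht⟩ := exists_finset_chartPartition k N
  rw [integral_eq_sum hs, integral_eq_sum ht]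
  calc _ = ∑ j ∈ t, ∑ i ∈ s, ∫ v in (extChartAt (𝓡 k) j).target,
        chartPartition k M i (Ψ ((extChartAt (𝓡 k) j).symm v)) *
        (chartPartition k N j ((extChartAt (𝓡 k) j).symm v) *
          ρ ((extChartAt (𝓡 k) j).symm v) (coordVectors j v)) := by
        refine Finset.sum_congr rfl fun j _ => ?_
        -- The partition of unity of `M`, pulled back by `Ψ`, is inserted. After the change of
        -- variables the partition of `N` is summed away instead.
        rw [← integral_finsetSum]
        · simp_rw [← Finset.sum_mul, sum_chartPartition hs, one_mul]
        · intro i _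
          refine (integrableOn_weight_mul j (((chartPartition k M i).contMDiff.continuous.comp
            hΨ).comp_continuousOn (continuousOn_extChartAt_symm j) |>.mul (hN j))).congr_fun ?_
            (isOpen_extChartAt_target j).measurableSet
          intro v _
          simp only [Function.comp_apply, Pi.mul_apply]
          ring
    _ = ∑ j ∈ t, ∑ i ∈ s, ∫ u in (extChartAt (𝓡 k) i).target,
        chartPartition k N j (Φ ((extChartAt (𝓡 k) i).symm u)) *
        (chartPartition k M i ((extChartAt (𝓡 k) i).symm u) *
          ρ (Φ ((extChartAt (𝓡 k) i).symm u)) (fun a =>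
            mfderiv (𝓡 k) (𝓡 k) Φ ((extChartAt (𝓡 k) i).symm u) (coordVectors i u a))) :=
        Finset.sum_congr rfl fun j _ => Finset.sum_congr rfl fun i _ =>
          setIntegral_coordMap hΦ h₁ h₂ hρ i j
    _ = _ := by
        rw [Finset.sum_comm]
        refine Finset.sum_congr rfl fun i _ => ?_
        rw [← integral_finsetSum]
        · simp_rw [← Finset.sum_mul, sum_chartPartition ht, one_mul]
        · intro j _
          refine (integrableOn_weight_mul i (((chartPartition k N j).contMDiff.continuous.comp
            hΦ.continuous).comp_continuousOn (continuousOn_extChartAt_symm i) |>.mul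
            (hM i))).congr_fun ?_ (isOpen_extChartAt_target i).measurableSet
          intro v _
          simp only [Function.comp_apply, Pi.mul_apply]
          ring

end ChangeOfVariables

/-! ### The push-forward in coordinates -/

section Coordinates

variable {n l k q : ℕ}
  {X : Type*} [TopologicalSpace X] [ChartedSpace (EuclideanSpace ℝ (Fin n)) X]
  {Y : Type*} [TopologicalSpace Y] [ChartedSpace (EuclideanSpace ℝ (Fin l)) Y]
  {F : Y → Type*} [∀ y, TopologicalSpace (F y)]
  [∀ y, ChartedSpace (EuclideanSpace ℝ (Fin k)) (F y)]
  {p : X → Y} (B : SmoothFiberBundle n l k p F)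

/-- The base of the domain of `totalChart`. -/
def baseDomain (y₀ y₁ : Y) : Set (EuclideanSpace ℝ (Fin l)) :=
  (extChartAt (𝓡 l) y₁).target ∩ (extChartAt (𝓡 l) y₁).symm ⁻¹' (B.triv y₀).baseSet

/-- The parametrization of an open part of `X` by the trivialization at `y₀`, the chart of `Y` at
`y₁` and the chart of the model fiber at `i`. -/
def totalChart (y₀ y₁ : Y) (i : F y₀) (e : EuclideanSpace ℝ (Fin l) × EuclideanSpace ℝ (Fin k)) :
    X :=
  (B.triv y₀).toOpenPartialHomeomorph.symm
    ((extChartAt (𝓡 l) y₁).symm e.1, (extChartAt (𝓡 k) i).symm e.2)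

/-- The image of the fiber model `F y₀` in the fiber over `y`. -/
def sliceMap (y₀ y : Y) (z : F y₀) : X :=
  (B.triv y₀).toOpenPartialHomeomorph.symm (y, z)

lemma isOpen_baseDomain (y₀ y₁ : Y) : IsOpen (baseDomain B y₀ y₁) :=
  (continuousOn_extChartAt_symm y₁).isOpen_inter_preimage (isOpen_extChartAt_target y₁)
    (B.triv y₀).open_baseSet

lemma mk_mem_target {y₀ y : Y} (hy : y ∈ (B.triv y₀).baseSet) (z : F y₀) :
    (y, z) ∈ (B.triv y₀).target :=
  (B.triv y₀).mem_target.2 hy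

lemma proj_totalChart {y₀ y₁ : Y} (i : F y₀)
    {e : EuclideanSpace ℝ (Fin l) × EuclideanSpace ℝ (Fin k)} (he : e.1 ∈ baseDomain B y₀ y₁) :
    p (totalChart B y₀ y₁ i e) = (extChartAt (𝓡 l) y₁).symm e.1 :=
  (B.triv y₀).proj_symm_apply (mk_mem_target B he.2 _)

lemma totalChart_mem_source {y₀ y₁ : Y} (i : F y₀)
    {e : EuclideanSpace ℝ (Fin l) × EuclideanSpace ℝ (Fin k)} (he : e.1 ∈ baseDomain B y₀ y₁) :
    totalChart B y₀ y₁ i e ∈ (B.triv y₀).source :=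
  (B.triv y₀).map_target (mk_mem_target B he.2 _)

lemma contMDiffAt_triv {y₀ : Y} {x : X} (hx : x ∈ (B.triv y₀).source) :
    ContMDiffAt (𝓡 n) ((𝓡 l).prod (𝓡 k)) ∞ (B.triv y₀) x :=
  (B.contMDiffOn y₀).contMDiffAt ((B.triv y₀).open_source.mem_nhds hx)

lemma contMDiffAt_proj {y₀ : Y} {x : X} (hx : x ∈ (B.triv y₀).source) :
    ContMDiffAt (𝓡 n) (𝓡 l) ∞ p x := by
  refine (contMDiffAt_fst.comp x (contMDiffAt_triv B hx)).congr_of_eventuallyEq ?_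
  filter_upwards [(B.triv y₀).open_source.mem_nhds hx] with x' hx'
  exact ((B.triv y₀).coe_fst hx').symm

lemma contMDiff_sliceMap {y₀ y : Y} (hy : y ∈ (B.triv y₀).baseSet) :
    ContMDiff (𝓡 k) (𝓡 n) ∞ (sliceMap B y₀ y) := by
  intro z
  refine ((B.contMDiffOn_symm y₀).contMDiffAt ((B.triv y₀).open_target.mem_nhds
    (mk_mem_target B hy z))).comp z (f := fun z => (y, z)) ?_
  exact contMDiffAt_const.prodMk contMDiffAt_id

/-- The transition between the model fibers `F y₀` and `F y₁` over `y`. -/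
def fiberTransition (y₀ y₁ y : Y) (z : F y₀) : F y₁ := (B.triv y₁ (sliceMap B y₀ y z)).2

lemma sliceMap_mem_source {y₀ y₁ y : Y} (h₀ : y ∈ (B.triv y₀).baseSet)
    (h₁ : y ∈ (B.triv y₁).baseSet) (z : F y₀) : sliceMap B y₀ y z ∈ (B.triv y₁).source := by
  rw [(B.triv y₁).mem_source]
  exact ((B.triv y₀).proj_symm_apply (mk_mem_target B h₀ z)).symm ▸ h₁

lemma contMDiff_fiberTransition {y₀ y₁ y : Y} (h₀ : y ∈ (B.triv y₀).baseSet)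
    (h₁ : y ∈ (B.triv y₁).baseSet) :
    ContMDiff (𝓡 k) (𝓡 k) ∞ (fiberTransition B y₀ y₁ y) := fun z =>
  contMDiffAt_snd.comp z ((contMDiffAt_triv B (sliceMap_mem_source B h₀ h₁ z)).comp z
    (contMDiff_sliceMap B h₀ z))

lemma sliceMap_fiberTransition {y₀ y₁ y : Y} (h₀ : y ∈ (B.triv y₀).baseSet)
    (h₁ : y ∈ (B.triv y₁).baseSet) (z : F y₀) :
    sliceMap B y₁ y (fiberTransition B y₀ y₁ y z) = sliceMap B y₀ y z := by
  have hp : p (sliceMap B y₀ y z) = y := (B.triv y₀).proj_symm_apply (mk_mem_target B h₀ z)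
  have := (B.triv y₁).symm_apply_mk_proj (sliceMap_mem_source B h₀ h₁ z)
  rw [hp] at this
  exact this

lemma fiberTransition_leftInverse {y₀ y₁ y : Y} (h₀ : y ∈ (B.triv y₀).baseSet)
    (h₁ : y ∈ (B.triv y₁).baseSet) :
    Function.LeftInverse (fiberTransition B y₁ y₀ y) (fiberTransition B y₀ y₁ y) := by
  intro z
  rw [fiberTransition, sliceMap_fiberTransition B h₀ h₁]
  exact congrArg Prod.snd ((B.triv y₀).apply_symm_apply (mk_mem_target B h₀ z))

lemma isOpen_totalDomain (y₀ y₁ : Y) (i : F y₀) :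
    IsOpen (baseDomain B y₀ y₁ ×ˢ (extChartAt (𝓡 k) i).target) :=
  (isOpen_baseDomain B y₀ y₁).prod (isOpen_extChartAt_target i)

variable [IsManifold (𝓡 l) ∞ Y] [∀ y, IsManifold (𝓡 k) ∞ (F y)]

lemma contMDiffOn_totalChart (y₀ y₁ : Y) (i : F y₀) :
    ContMDiffOn 𝓘(ℝ, EuclideanSpace ℝ (Fin l) × EuclideanSpace ℝ (Fin k)) (𝓡 n) ∞
      (totalChart B y₀ y₁ i) (baseDomain B y₀ y₁ ×ˢ (extChartAt (𝓡 k) i).target) := by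
  refine (B.contMDiffOn_symm y₀).comp (f := fun e : EuclideanSpace ℝ (Fin l) ×
    EuclideanSpace ℝ (Fin k) => ((extChartAt (𝓡 l) y₁).symm e.1, (extChartAt (𝓡 k) i).symm e.2))
    (ContMDiffOn.prodMk ?_ ?_) ?_
  · exact (contMDiffOn_extChartAt_symm y₁).comp contDiff_fst.contMDiff.contMDiffOn
      fun e he => he.1.1
  · exact (contMDiffOn_extChartAt_symm i).comp contDiff_snd.contMDiff.contMDiffOn
      fun e he => he.2
  · intro e he
    exact mk_mem_target B he.1.2 _

lemma hasMFDerivAt_totalChart {y₀ y₁ : Y} {i : F y₀}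
    {e : EuclideanSpace ℝ (Fin l) × EuclideanSpace ℝ (Fin k)}
    (he : e ∈ baseDomain B y₀ y₁ ×ˢ (extChartAt (𝓡 k) i).target) :
    HasMFDerivAt 𝓘(ℝ, EuclideanSpace ℝ (Fin l) × EuclideanSpace ℝ (Fin k)) (𝓡 n)
      (totalChart B y₀ y₁ i) e (mfderiv 𝓘(ℝ, EuclideanSpace ℝ (Fin l) ×
        EuclideanSpace ℝ (Fin k)) (𝓡 n) (totalChart B y₀ y₁ i) e) :=
  (((contMDiffOn_totalChart B y₀ y₁ i).contMDiffAt
    ((isOpen_totalDomain B y₀ y₁ i).mem_nhds he)).mdifferentiableAt (by norm_num)).hasMFDerivAt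

/-- The projection in the coordinates of `totalChart` is the first projection. -/
lemma mfderiv_proj_totalChart {y₀ y₁ : Y} {i : F y₀}
    {e : EuclideanSpace ℝ (Fin l) × EuclideanSpace ℝ (Fin k)}
    (he : e ∈ baseDomain B y₀ y₁ ×ˢ (extChartAt (𝓡 k) i).target)
    (w : EuclideanSpace ℝ (Fin l) × EuclideanSpace ℝ (Fin k)) :
    @Eq (EuclideanSpace ℝ (Fin l))
      (mfderiv (𝓡 n) (𝓡 l) p (totalChart B y₀ y₁ i e)
        (mfderiv 𝓘(ℝ, EuclideanSpace ℝ (Fin l) × EuclideanSpace ℝ (Fin k)) (𝓡 n)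
          (totalChart B y₀ y₁ i) e w))
      (mfderiv (𝓡 l) (𝓡 l) (extChartAt (𝓡 l) y₁).symm e.1 w.1) := by
  have hp := ((contMDiffAt_proj B (totalChart_mem_source B i he.1)).mdifferentiableAt
    (by norm_num)).hasMFDerivAt
  have h1 := HasMFDerivAt.comp e hp (hasMFDerivAt_totalChart B he)
  have hfst : HasMFDerivAt 𝓘(ℝ, EuclideanSpace ℝ (Fin l) × EuclideanSpace ℝ (Fin k)) (𝓡 l)
      (Prod.fst : EuclideanSpace ℝ (Fin l) × EuclideanSpace ℝ (Fin k) → _) e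
      (ContinuousLinearMap.fst ℝ (EuclideanSpace ℝ (Fin l)) (EuclideanSpace ℝ (Fin k))) :=
    hasFDerivAt_fst.hasMFDerivAt
  have h2 := HasMFDerivAt.comp e (mdifferentiableAt_extChartAt_symm he.1.1).hasMFDerivAt hfst
  have h3 : p ∘ totalChart B y₀ y₁ i =ᶠ[𝓝 e] (extChartAt (𝓡 l) y₁).symm ∘ Prod.fst := by
    filter_upwards [(isOpen_totalDomain B y₀ y₁ i).mem_nhds he] with e' he'
    exact proj_totalChart B i he'.1
  have h4 := hasMFDerivAt_unique h1 (h2.congr_of_eventuallyEq h3)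
  exact congrArg (fun L : (EuclideanSpace ℝ (Fin l) × EuclideanSpace ℝ (Fin k)) →L[ℝ]
    EuclideanSpace ℝ (Fin l) => L w) h4

/-- Vertical vectors are tangent to the fiber. -/
lemma exists_of_mfderiv_proj_eq_zero {y₀ y₁ : Y} {i : F y₀}
    {e : EuclideanSpace ℝ (Fin l) × EuclideanSpace ℝ (Fin k)}
    (he : e ∈ baseDomain B y₀ y₁ ×ˢ (extChartAt (𝓡 k) i).target) {x : X}
    (hx : totalChart B y₀ y₁ i e = x) {ζ : TangentSpace (𝓡 n) x}
    (hζ : mfderiv (𝓡 n) (𝓡 l) p x ζ = 0) :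
    ∃ w : EuclideanSpace ℝ (Fin k), @Eq (EuclideanSpace ℝ (Fin n))
      (mfderiv 𝓘(ℝ, EuclideanSpace ℝ (Fin l) × EuclideanSpace ℝ (Fin k)) (𝓡 n)
          (totalChart B y₀ y₁ i) e ((0 : EuclideanSpace ℝ (Fin l)), w)) ζ := by
  have hxs : x ∈ (B.triv y₀).source := hx ▸ totalChart_mem_source B i he.1
  have hpx : p x = (extChartAt (𝓡 l) y₁).symm e.1 := hx ▸ proj_totalChart B i he.1
  have hTx : B.triv y₀ x =
      ((extChartAt (𝓡 l) y₁).symm e.1, (extChartAt (𝓡 k) i).symm e.2) := by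
    rw [← hx]
    exact (B.triv y₀).apply_symm_apply (mk_mem_target B he.1.2 _)
  have hp := (contMDiffAt_proj B hxs).mdifferentiableAt (by norm_num)
  have hs1 : p x ∈ (extChartAt (𝓡 l) y₁).source := by
    rw [hpx]
    exact (extChartAt (𝓡 l) y₁).map_target he.1.1
  have hs2 : (B.triv y₀ x).2 ∈ (extChartAt (𝓡 k) i).source := by
    rw [hTx]
    exact (extChartAt (𝓡 k) i).map_target he.2
  have hc1 : MDifferentiableAt (𝓡 l) 𝓘(ℝ, EuclideanSpace ℝ (Fin l)) (extChartAt (𝓡 l) y₁) (p x) :=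
    (contMDiffAt_extChartAt' (n := ∞) (by simpa using hs1)).mdifferentiableAt (by norm_num)
  have hR1 : HasMFDerivAt (𝓡 n) 𝓘(ℝ, EuclideanSpace ℝ (Fin l)) (extChartAt (𝓡 l) y₁ ∘ p) x
      ((mfderiv (𝓡 l) 𝓘(ℝ, EuclideanSpace ℝ (Fin l)) (extChartAt (𝓡 l) y₁) (p x)).comp
        (mfderiv (𝓡 n) (𝓡 l) p x)) :=
    HasMFDerivAt.comp x hc1.hasMFDerivAt hp.hasMFDerivAt
  have hR2 : ContMDiffAt (𝓡 n) 𝓘(ℝ, EuclideanSpace ℝ (Fin k)) ∞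
      (extChartAt (𝓡 k) i ∘ fun x => (B.triv y₀ x).2) x :=
    ContMDiffAt.comp x (contMDiffAt_extChartAt' (n := ∞) (by simpa using hs2))
      (contMDiffAt_snd.comp x (contMDiffAt_triv B hxs))
  -- `R` is the local inverse of `totalChart`. Its derivative sends `ζ` to a vector whose first
  -- component is computed from `dp ζ = 0`, so it has the form `(0, w)`.
  let R : X → EuclideanSpace ℝ (Fin l) × EuclideanSpace ℝ (Fin k) := fun x =>
    (extChartAt (𝓡 l) y₁ (p x), extChartAt (𝓡 k) i (B.triv y₀ x).2)
  have hR : HasMFDerivAt (𝓡 n) 𝓘(ℝ, EuclideanSpace ℝ (Fin l) × EuclideanSpace ℝ (Fin k)) R x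
      (mfderiv (𝓡 n) 𝓘(ℝ, EuclideanSpace ℝ (Fin l) × EuclideanSpace ℝ (Fin k)) R x) :=
    (hR1.mdifferentiableAt.prodMk_space (hR2.mdifferentiableAt (by norm_num))).hasMFDerivAt
  have hRx : R x = e := by
    refine Prod.ext ?_ ?_
    · change extChartAt (𝓡 l) y₁ (p x) = _
      rw [hpx]
      exact (extChartAt (𝓡 l) y₁).right_inv he.1.1
    · change extChartAt (𝓡 k) i (B.triv y₀ x).2 = _
      rw [hTx]
      exact (extChartAt (𝓡 k) i).right_inv he.2
  have hfst : HasMFDerivAt 𝓘(ℝ, EuclideanSpace ℝ (Fin l) × EuclideanSpace ℝ (Fin k)) (𝓡 l)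
      (Prod.fst : EuclideanSpace ℝ (Fin l) × EuclideanSpace ℝ (Fin k) → _) (R x)
      (ContinuousLinearMap.fst ℝ (EuclideanSpace ℝ (Fin l)) (EuclideanSpace ℝ (Fin k))) :=
    hasFDerivAt_fst.hasMFDerivAt
  have h1 := hasMFDerivAt_unique (HasMFDerivAt.comp x hfst hR) hR1
  have hT := hasMFDerivAt_totalChart B (e := R x) (hRx ▸ he)
  have hinv : totalChart B y₀ y₁ i ∘ R =ᶠ[𝓝 x] id := by
    have e1 : ∀ᶠ x' in 𝓝 x, p x' ∈ (extChartAt (𝓡 l) y₁).source :=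
      hp.continuousAt ((isOpen_extChartAt_source y₁).mem_nhds hs1)
    have e2 : ∀ᶠ x' in 𝓝 x, (B.triv y₀ x').2 ∈ (extChartAt (𝓡 k) i).source :=
      (contMDiffAt_snd.comp x (contMDiffAt_triv B hxs)).continuousAt
        ((isOpen_extChartAt_source i).mem_nhds hs2)
    filter_upwards [e1, e2, (B.triv y₀).open_source.mem_nhds hxs] with x' h1 h2 h3
    change (B.triv y₀).toOpenPartialHomeomorph.symm
      ((extChartAt (𝓡 l) y₁).symm (extChartAt (𝓡 l) y₁ (p x')),
        (extChartAt (𝓡 k) i).symm (extChartAt (𝓡 k) i (B.triv y₀ x').2)) = x'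
    rw [(extChartAt (𝓡 l) y₁).left_inv h1, (extChartAt (𝓡 k) i).left_inv h2]
    exact (B.triv y₀).symm_apply_mk_proj h3
  have h2 := hasMFDerivAt_unique (HasMFDerivAt.comp x hT hR)
    ((hasMFDerivAt_id x).congr_of_eventuallyEq hinv)
  have h1' : (mfderiv (𝓡 n) 𝓘(ℝ, EuclideanSpace ℝ (Fin l) × EuclideanSpace ℝ (Fin k)) R x ζ :
      EuclideanSpace ℝ (Fin l) × EuclideanSpace ℝ (Fin k)).1 = 0 := by
    have h3 := congrArg (fun L : EuclideanSpace ℝ (Fin n) →L[ℝ] EuclideanSpace ℝ (Fin l) => L ζ) h1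
    refine h3.trans ?_
    change mfderiv (𝓡 l) 𝓘(ℝ, EuclideanSpace ℝ (Fin l)) (extChartAt (𝓡 l) y₁) (p x)
      (mfderiv (𝓡 n) (𝓡 l) p x ζ) = 0
    rw [hζ]
    exact map_zero _
  have h2' := congrArg (fun L : EuclideanSpace ℝ (Fin n) →L[ℝ] EuclideanSpace ℝ (Fin n) => L ζ) h2
  refine ⟨(mfderiv (𝓡 n) 𝓘(ℝ, EuclideanSpace ℝ (Fin l) × EuclideanSpace ℝ (Fin k)) R x ζ :
      EuclideanSpace ℝ (Fin l) × EuclideanSpace ℝ (Fin k)).2, Eq.trans ?_ h2'⟩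
  -- `R x` equals `e` only propositionally; this transports the derivative from one point to the
  -- other.
  have key : ∀ e', e' = e → ∀ w w' : EuclideanSpace ℝ (Fin l) × EuclideanSpace ℝ (Fin k), w = w' →
      @Eq (EuclideanSpace ℝ (Fin n))
        (mfderiv 𝓘(ℝ, EuclideanSpace ℝ (Fin l) × EuclideanSpace ℝ (Fin k)) (𝓡 n)
          (totalChart B y₀ y₁ i) e w)
        (mfderiv 𝓘(ℝ, EuclideanSpace ℝ (Fin l) × EuclideanSpace ℝ (Fin k)) (𝓡 n)
          (totalChart B y₀ y₁ i) e' w') := by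
    rintro _ rfl _ _ rfl
    rfl
  exact key _ hRx _ _ (Prod.ext h1'.symm rfl)

/-- The chart of the fiber is the restriction of `totalChart`. -/
lemma mfderiv_sliceMap_coordVectors {y₀ y₁ y : Y} {i : F y₀}
    {e : EuclideanSpace ℝ (Fin l) × EuclideanSpace ℝ (Fin k)}
    (he : e ∈ baseDomain B y₀ y₁ ×ˢ (extChartAt (𝓡 k) i).target)
    (hy : (extChartAt (𝓡 l) y₁).symm e.1 = y) (w : EuclideanSpace ℝ (Fin k)) :
    @Eq (EuclideanSpace ℝ (Fin n))
      (mfderiv (𝓡 k) (𝓡 n) (sliceMap B y₀ y) ((extChartAt (𝓡 k) i).symm e.2)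
        (mfderiv (𝓡 k) (𝓡 k) (extChartAt (𝓡 k) i).symm e.2 w))
      (mfderiv 𝓘(ℝ, EuclideanSpace ℝ (Fin l) × EuclideanSpace ℝ (Fin k)) (𝓡 n)
          (totalChart B y₀ y₁ i) e ((0 : EuclideanSpace ℝ (Fin l)), w)) := by
  subst hy
  have h1 := HasMFDerivAt.comp e.2 ((contMDiff_sliceMap B he.1.2 _).mdifferentiableAt
    (by norm_num)).hasMFDerivAt (mdifferentiableAt_extChartAt_symm he.2).hasMFDerivAt
  have hinr : HasMFDerivAt 𝓘(ℝ, EuclideanSpace ℝ (Fin k))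
      𝓘(ℝ, EuclideanSpace ℝ (Fin l) × EuclideanSpace ℝ (Fin k))
      (fun u => (e.1, u)) e.2
      (ContinuousLinearMap.inr ℝ (EuclideanSpace ℝ (Fin l)) (EuclideanSpace ℝ (Fin k))) :=
    (hasFDerivAt_prodMk_right e.1 e.2).hasMFDerivAt
  have h2 := HasMFDerivAt.comp e.2 (hasMFDerivAt_totalChart B he) hinr
  have h3 := hasMFDerivAt_unique h1 h2
  exact congrArg (fun L : EuclideanSpace ℝ (Fin k) →L[ℝ] EuclideanSpace ℝ (Fin n) => L w) h3

end Coordinates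

/-! ### The push-forward as a sum of integrals over coordinate domains -/

section PushForward

/-! ### Absolute values of decomposable forms on one vector space -/

section PointwiseDecomposable

variable {V : Type*} [AddCommGroup V] [Module ℝ V] [TopologicalSpace V] {q k m : ℕ}

/-- `D` is the absolute value of a decomposable form. -/
def IsAbsDecomposable (D : (Fin m → V) → ℝ) : Prop :=
  ∃ (c : ℝ) (φ : Fin m → (V →L[ℝ] ℝ)), ∀ ξ, D ξ = |c * wedge φ ξ|

lemma IsAbsDecomposable.contraction {D : (Fin (q + k) → V) → ℝ} (hD : IsAbsDecomposable D)
    (f : Fin k → V) : ∃ (c : ℝ) (ψ : Fin q → (V →L[ℝ] ℝ)), (∀ i j, ψ i (f j) = 0) ∧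
      ∀ ξ, D (Fin.append ξ f) = |c * wedge ψ ξ| := by
  obtain ⟨c, φ, h⟩ := hD
  obtain ⟨c', ψ, h0, h1⟩ := exists_contraction φ f
  exact ⟨c * c', ψ, h0, fun ξ => by rw [h, h1, mul_assoc]⟩

/-- The factors of the contracted form vanish on the span of `f`. This is the independence of the
push-forward of the choice of lifts. -/
lemma IsAbsDecomposable.append_congr {D : (Fin (q + k) → V) → ℝ} (hD : IsAbsDecomposable D)
    {f : Fin k → V} {ξ s : Fin q → V} (h : ∀ i, ξ i - s i ∈ Submodule.span ℝ (range f)) :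
    D (Fin.append ξ f) = D (Fin.append s f) := by
  obtain ⟨c, ψ, h0, h1⟩ := hD.contraction f
  have h2 : ∀ i j, ψ i (ξ j) = ψ i (s j) := by
    intro i j
    have h3 : Submodule.span ℝ (range f) ≤ LinearMap.ker (ψ i : V →ₗ[ℝ] ℝ) := by
      rw [Submodule.span_le]
      rintro _ ⟨a, rfl⟩
      exact h0 i a
    have h4 : ψ i (ξ j - s j) = 0 := h3 (h j)
    rwa [map_sub, sub_eq_zero] at h4
  rw [h1, h1, wedge_apply, wedge_apply]
  simp only [h2]

lemma IsAbsDecomposable.append_comb {D : (Fin (q + k) → V) → ℝ} (hD : IsAbsDecomposable D)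
    (ξ : Fin q → V) (f : Fin k → V) (A : Matrix (Fin k) (Fin k) ℝ) :
    D (Fin.append ξ fun b => ∑ a, A a b • f a) = |A.det| * D (Fin.append ξ f) := by
  obtain ⟨c, φ, h⟩ := hD
  rw [h, h, wedge_append_comb, ← abs_mul]
  congr 1
  ring

end PointwiseDecomposable

variable {n l k q : ℕ}
  {X : Type*} [TopologicalSpace X] [ChartedSpace (EuclideanSpace ℝ (Fin n)) X]
  {Y : Type*} [TopologicalSpace Y] [ChartedSpace (EuclideanSpace ℝ (Fin l)) Y]
  {F : Y → Type*} [∀ y, TopologicalSpace (F y)]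
  [∀ y, ChartedSpace (EuclideanSpace ℝ (Fin k)) (F y)]
  {p : X → Y} (B : SmoothFiberBundle n l k p F)

lemma LocallyDecomposable.isAbsDecomposable {m : ℕ} [IsManifold (𝓡 n) ∞ X]
    {δ : TangentFunction n m X} (hδ : LocallyDecomposable δ) (x : X) :
    IsAbsDecomposable (δ x) := by
  obtain ⟨U, -, hx, c, φ, -, -, h⟩ := hδ x
  exact ⟨c x, fun i => φ i x, h x hx⟩

/-- `lift` chooses by an equation in the tangent bundle; its property holds once some lift exists.
-/
lemma mfderiv_lift {x : X} {y : Y} {η : TangentSpace (𝓡 l) y} (hy : p x = y)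
    (h : ∃ ξ : TangentSpace (𝓡 n) x,
      @Eq (EuclideanSpace ℝ (Fin l)) (mfderiv (𝓡 n) (𝓡 l) p x ξ) η) :
    @Eq (EuclideanSpace ℝ (Fin l)) (mfderiv (𝓡 n) (𝓡 l) p x (lift n l p x η)) η := by
  subst hy
  have h1 : ∃ ξ : TangentSpace (𝓡 n) x, tangentMap (𝓡 n) (𝓡 l) p ⟨x, ξ⟩ =
      (⟨p x, η⟩ : TangentBundle (𝓡 l) Y) := by
    obtain ⟨ξ, hξ⟩ := h
    exact ⟨ξ, congrArg (fun w : TangentSpace (𝓡 l) (p x) =>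
      (⟨p x, w⟩ : TangentBundle (𝓡 l) Y)) hξ⟩
  have h2 := Classical.epsilon_spec h1
  exact congrArg (fun w : TangentBundle (𝓡 l) Y =>
    (show EuclideanSpace ℝ (Fin l) from w.2)) h2

/-- The vectors of the standard basis of the second factor, preceded by `v` in the first factor. -/
def coordFrame (v : Fin q → EuclideanSpace ℝ (Fin l)) :
    Fin (q + k) → EuclideanSpace ℝ (Fin l) × EuclideanSpace ℝ (Fin k) :=
  Fin.append (fun i => (v i, 0)) (fun j => (0, EuclideanSpace.single j (1 : ℝ)))

/-- The integrand of the push-forward in the coordinates given by `totalChart`. -/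
def fiberIntegrand (δ : TangentFunction n (q + k) X) (y₀ y₁ : Y) (i : F y₀)
    (e : EuclideanSpace ℝ (Fin l) × EuclideanSpace ℝ (Fin k))
    (v : Fin q → EuclideanSpace ℝ (Fin l)) : ℝ :=
  δ (totalChart B y₀ y₁ i e) fun j =>
    mfderiv 𝓘(ℝ, EuclideanSpace ℝ (Fin l) × EuclideanSpace ℝ (Fin k)) (𝓡 n)
      (totalChart B y₀ y₁ i) e (coordFrame v j)

lemma continuous_coordFrame : Continuous (coordFrame (l := l) (q := q) (k := k)) := by
  refine continuous_pi fun j => ?_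
  refine Fin.addCases (fun j => ?_) (fun j => ?_) j
  · simp only [coordFrame, Fin.append_left]
    fun_prop
  · simp only [coordFrame, Fin.append_right]
    fun_prop

lemma mk_mem_totalDomain {y₀ y₁ y : Y} (h₀ : y ∈ (B.triv y₀).baseSet)
    (h₁ : y ∈ (extChartAt (𝓡 l) y₁).source) : extChartAt (𝓡 l) y₁ y ∈ baseDomain B y₀ y₁ := by
  refine ⟨(extChartAt (𝓡 l) y₁).map_source h₁, ?_⟩
  rw [mem_preimage, (extChartAt (𝓡 l) y₁).left_inv h₁]
  exact h₀

variable [IsManifold (𝓡 l) ∞ Y] [∀ y, IsManifold (𝓡 k) ∞ (F y)]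

lemma symm_trivializationAt_eq_mfderiv {y₁ y : Y}
    (h₁ : y ∈ (chartAt (EuclideanSpace ℝ (Fin l)) y₁).source) (v : EuclideanSpace ℝ (Fin l)) :
    @Eq (EuclideanSpace ℝ (Fin l))
      ((trivializationAt (EuclideanSpace ℝ (Fin l)) (TangentSpace (𝓡 l)) y₁).symm y v)
      (mfderiv (𝓡 l) (𝓡 l) (extChartAt (𝓡 l) y₁).symm (extChartAt (𝓡 l) y₁ y) v) := by
  have : IsManifold (𝓡 l) 1 Y := IsManifold.of_le (n := ∞) (by norm_num)
  have h := TangentBundle.symmL_trivializationAt (I := 𝓡 l) h₁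
  rw [show range (𝓡 l) = univ from (𝓡 l).range_eq_univ, mfderivWithin_univ] at h
  have hb : y ∈ (trivializationAt (EuclideanSpace ℝ (Fin l)) (TangentSpace (𝓡 l)) y₁).baseSet := h₁
  refine ((trivializationAt (EuclideanSpace ℝ (Fin l)) (TangentSpace (𝓡 l)) y₁).symmL_apply
    (R := ℝ) hb v).symm.trans ?_
  exact congrArg (fun L : EuclideanSpace ℝ (Fin l) →L[ℝ] EuclideanSpace ℝ (Fin l) => L v) h

/-- The integrand of the push-forward is independent of the choice of lifts. -/
lemma fiberIntegrand_eq [IsManifold (𝓡 n) ∞ X] {δ : TangentFunction n (q + k) X}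
    (hδ : LocallyDecomposable δ) {y₀ y₁ y : Y}
    (h₀ : y ∈ (B.triv y₀).baseSet) (h₁ : y ∈ (chartAt (EuclideanSpace ℝ (Fin l)) y₁).source)
    (i : F y₀) {u : EuclideanSpace ℝ (Fin k)} (hu : u ∈ (extChartAt (𝓡 k) i).target)
    (v : Fin q → EuclideanSpace ℝ (Fin l)) (η : Fin q → TangentSpace (𝓡 l) y)
    (hη : ∀ j, η j =
      (trivializationAt (EuclideanSpace ℝ (Fin l)) (TangentSpace (𝓡 l)) y₁).symm y (v j)) :
    δ (sliceMap B y₀ y ((extChartAt (𝓡 k) i).symm u))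
      (Fin.append (fun j => lift n l p (sliceMap B y₀ y ((extChartAt (𝓡 k) i).symm u)) (η j))
        (fun j => mfderiv (𝓡 k) (𝓡 n) (sliceMap B y₀ y) ((extChartAt (𝓡 k) i).symm u)
          (coordVectors i u j))) =
      fiberIntegrand B δ y₀ y₁ i (extChartAt (𝓡 l) y₁ y, u) v := by
  have h₁' : y ∈ (extChartAt (𝓡 l) y₁).source := by rwa [extChartAt_source]
  set e : EuclideanSpace ℝ (Fin l) × EuclideanSpace ℝ (Fin k) := (extChartAt (𝓡 l) y₁ y, u)
  have he : e ∈ baseDomain B y₀ y₁ ×ˢ (extChartAt (𝓡 k) i).target :=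
    ⟨mk_mem_totalDomain B h₀ h₁', hu⟩
  have hy : (extChartAt (𝓡 l) y₁).symm e.1 = y := (extChartAt (𝓡 l) y₁).left_inv h₁'
  set x : X := sliceMap B y₀ y ((extChartAt (𝓡 k) i).symm u)
  have hx : totalChart B y₀ y₁ i e = x := by
    rw [totalChart, hy]
    rfl
  let T : EuclideanSpace ℝ (Fin l) × EuclideanSpace ℝ (Fin k) →L[ℝ] EuclideanSpace ℝ (Fin n) :=
    mfderiv 𝓘(ℝ, EuclideanSpace ℝ (Fin l) × EuclideanSpace ℝ (Fin k)) (𝓡 n)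
      (totalChart B y₀ y₁ i) e
  let P : EuclideanSpace ℝ (Fin n) →L[ℝ] EuclideanSpace ℝ (Fin l) := mfderiv (𝓡 n) (𝓡 l) p x
  have hPT : ∀ w, P (T w) = mfderiv (𝓡 l) (𝓡 l) (extChartAt (𝓡 l) y₁).symm e.1 w.1 := by
    intro w
    have key : ∀ x', x' = x → ∀ z : EuclideanSpace ℝ (Fin n),
        P z = (mfderiv (𝓡 n) (𝓡 l) p x' z : EuclideanSpace ℝ (Fin l)) := by
      rintro _ rfl z
      rfl
    exact (key _ hx _).trans (mfderiv_proj_totalChart B he w)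
  have hsec : ∀ j, P (T (v j, 0)) = η j := by
    intro j
    rw [hPT, hη]
    exact (symm_trivializationAt_eq_mfderiv h₁ (v j)).symm
  have hpx : p x = y := (B.triv y₀).proj_symm_apply (mk_mem_target B h₀ _)
  let ξ : Fin q → EuclideanSpace ℝ (Fin n) := fun j => lift n l p x (η j)
  have hlift : ∀ j, P (ξ j) = η j := fun j =>
    mfderiv_lift hpx ⟨T (v j, 0), hsec j⟩
  let f : Fin k → EuclideanSpace ℝ (Fin n) := fun j => T (0, EuclideanSpace.single j (1 : ℝ))
  have hf : ∀ j, @Eq (EuclideanSpace ℝ (Fin n)) (mfderiv (𝓡 k) (𝓡 n) (sliceMap B y₀ y)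
      ((extChartAt (𝓡 k) i).symm u) (coordVectors i u j)) (f j) := fun j =>
    mfderiv_sliceMap_coordVectors B he hy _
  -- The chosen lift and the coordinate lift `T (v j, 0)` have the same projection. Their difference
  -- is vertical, hence a combination of the fiber vectors `f`.
  have hspan : ∀ j, ξ j - T (v j, 0) ∈
      Submodule.span ℝ (range f) := by
    intro j
    have h0 : P (ξ j - T (v j, 0)) = 0 := by
      rw [map_sub, hlift, hsec]
      exact sub_self _
    obtain ⟨w, hw⟩ := exists_of_mfderiv_proj_eq_zero B he hx h0
    rw [← hw]
    have hw' : ((0 : EuclideanSpace ℝ (Fin l)), w) =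
        ∑ a, w a • ((0 : EuclideanSpace ℝ (Fin l)), EuclideanSpace.single a (1 : ℝ)) := by
      refine Prod.ext ?_ ?_
      · simp [Prod.fst_sum]
      · rw [Prod.snd_sum]
        ext b
        simp [Pi.single_apply]
    have hTw : T (0, w) = ∑ a, w a • f a := by
      rw [hw', map_sum]
      simp only [map_smul, f]
    change T (0, w) ∈ _
    rw [hTw]
    exact Submodule.sum_mem _ fun a _ => Submodule.smul_mem _ _ (Submodule.subset_span ⟨a, rfl⟩)
  have hD : IsAbsDecomposable (V := EuclideanSpace ℝ (Fin n)) (δ x) := hδ.isAbsDecomposable x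
  have h1 := hD.append_congr hspan
  refine Eq.trans ?_ (h1.trans ?_)
  · refine δ.congr rfl fun j => ?_
    refine Fin.addCases (fun j => ?_) (fun j => ?_) j
    · rw [Fin.append_left, Fin.append_left]
    · rw [Fin.append_right, Fin.append_right]
      exact hf j
  · refine δ.congr hx.symm fun j => ?_
    refine Fin.addCases (fun j => ?_) (fun j => ?_) j
    · rw [Fin.append_left, coordFrame, Fin.append_left]
      rfl
    · rw [Fin.append_right, coordFrame, Fin.append_right]
      rfl

lemma continuousOn_fiberIntegrand [IsManifold (𝓡 n) ∞ X] {δ : TangentFunction n (q + k) X}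
    (hδ : IsContinuousField δ) (y₀ y₁ : Y) (i : F y₀) :
    ContinuousOn (fun z : (EuclideanSpace ℝ (Fin l) × EuclideanSpace ℝ (Fin k)) ×
      (Fin q → EuclideanSpace ℝ (Fin l)) => fiberIntegrand B δ y₀ y₁ i z.1 z.2)
      ((baseDomain B y₀ y₁ ×ˢ (extChartAt (𝓡 k) i).target) ×ˢ univ) := by
  have h := hδ.continuousOn_comp_mfderiv (isOpen_totalDomain B y₀ y₁ i)
    (contMDiffOn_totalChart B y₀ y₁ i)
  exact h.comp (f := fun z : (EuclideanSpace ℝ (Fin l) × EuclideanSpace ℝ (Fin k)) ×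
      (Fin q → EuclideanSpace ℝ (Fin l)) => (z.1, coordFrame z.2))
    (continuous_fst.prodMk (continuous_coordFrame.comp continuous_snd)).continuousOn
    fun z hz => ⟨hz.1, mem_univ _⟩

lemma continuousOn_fiberIntegrand_right [IsManifold (𝓡 n) ∞ X] {δ : TangentFunction n (q + k) X}
    (hδ : IsContinuousField δ) {y₀ y₁ : Y} (i : F y₀) {a : EuclideanSpace ℝ (Fin l)}
    (ha : a ∈ baseDomain B y₀ y₁) (v : Fin q → EuclideanSpace ℝ (Fin l)) :
    ContinuousOn (fun u => fiberIntegrand B δ y₀ y₁ i (a, u) v) (extChartAt (𝓡 k) i).target :=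
  (continuousOn_fiberIntegrand B hδ y₀ y₁ i).comp (f := fun u => ((a, u), v))
    (by fun_prop) fun _ hu => ⟨⟨ha, hu⟩, mem_univ _⟩

end PushForward

/-! ### Normality of the push-forward -/

section Main

variable {n l k q : ℕ}
  {X : Type*} [TopologicalSpace X] [ChartedSpace (EuclideanSpace ℝ (Fin n)) X]
  {Y : Type*} [TopologicalSpace Y] [ChartedSpace (EuclideanSpace ℝ (Fin l)) Y]
  {F : Y → Type*} [∀ y, TopologicalSpace (F y)]
  [∀ y, ChartedSpace (EuclideanSpace ℝ (Fin k)) (F y)]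
  {p : X → Y} (B : SmoothFiberBundle n l k p F)

/-- The two embeddings of the model fibers onto the fiber over `y` differ by `fiberTransition`, so
the chain rule identifies the pulled back density. -/
lemma fiberDensity_fiberTransition (δ : TangentFunction n (q + k) X) {y₀ y : Y}
    (h₀ : y ∈ (B.triv y₀).baseSet) (η : Fin q → TangentSpace (𝓡 l) y) (z : F y₀)
    (f : Fin k → TangentSpace (𝓡 k) z) :
    fiberDensity B δ y η (fiberTransition B y₀ y y z)
      (fun a => mfderiv (𝓡 k) (𝓡 k) (fiberTransition B y₀ y y) z (f a)) =
    δ (sliceMap B y₀ y z) (Fin.append (fun j => lift n l p (sliceMap B y₀ y z) (η j))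
        (fun j => mfderiv (𝓡 k) (𝓡 n) (sliceMap B y₀ y) z (f j))) := by
  have hy := B.mem_baseSet y
  have hx : B.fiberMap y (fiberTransition B y₀ y y z) = sliceMap B y₀ y z :=
    sliceMap_fiberTransition B h₀ hy z
  refine δ.congr hx fun j => ?_
  refine Fin.addCases (fun j => ?_) (fun j => ?_) j
  · rw [Fin.append_left, Fin.append_left]
    have key : ∀ x x' : X, x = x' → @Eq (EuclideanSpace ℝ (Fin n))
        (lift n l p x (η j)) (lift n l p x' (η j)) := by
      rintro x _ rfl
      rfl
    exact key _ _ hx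
  · rw [Fin.append_right, Fin.append_right]
    have h1 := HasMFDerivAt.comp z ((contMDiff_sliceMap B hy _).mdifferentiableAt
      (by norm_num)).hasMFDerivAt
      ((contMDiff_fiberTransition B h₀ hy z).mdifferentiableAt (by norm_num)).hasMFDerivAt
    have h2 : sliceMap B y y ∘ fiberTransition B y₀ y y = sliceMap B y₀ y :=
      funext (sliceMap_fiberTransition B h₀ hy)
    rw [h2] at h1
    exact congrArg (fun L : EuclideanSpace ℝ (Fin k) →L[ℝ] EuclideanSpace ℝ (Fin n) => L (f j))
      h1.mfderiv.symm

variable [IsManifold (𝓡 n) ∞ X]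

lemma fiberDensity_comb {δ : TangentFunction n (q + k) X} (hδ : LocallyDecomposable δ) (y : Y)
    (η : Fin q → TangentSpace (𝓡 l) y) (z : F y) (A : Matrix (Fin k) (Fin k) ℝ)
    (f : Fin k → TangentSpace (𝓡 k) z) :
    fiberDensity B δ y η z (fun b => ∑ a, A a b • f a) = |A.det| * fiberDensity B δ y η z f := by
  have h := (hδ.isAbsDecomposable (B.fiberMap y z)).append_comb
    (fun i => lift n l p (B.fiberMap y z) (η i))
    (fun j => mfderiv (𝓡 k) (𝓡 n) (B.fiberMap y) z (f j)) A
  simp only [fiberDensity, map_sum, map_smul]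
  exact h

variable [IsManifold (𝓡 l) ∞ Y] [∀ y, IsManifold (𝓡 k) ∞ (F y)]
  [∀ y, CompactSpace (F y)] [∀ y, T2Space (F y)]

/-- The push-forward near `y₀` as a sum of integrals over charts of the fixed fiber `F y₀`. -/
lemma pushforward_eq_sum {δ : TangentFunction n (q + k) X} (hδ : LocallyDecomposable δ)
    (hc : IsContinuousField δ) {y₀ y₁ y : Y} (h₀ : y ∈ (B.triv y₀).baseSet)
    (h₁ : y ∈ (chartAt (EuclideanSpace ℝ (Fin l)) y₁).source) {s : Finset (F y₀)}
    (hs : ∀ i ∉ s, ∀ x, chartPartition k (F y₀) i x = 0)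
    (v : Fin q → EuclideanSpace ℝ (Fin l)) (η : Fin q → TangentSpace (𝓡 l) y)
    (hη : ∀ j, η j =
      (trivializationAt (EuclideanSpace ℝ (Fin l)) (TangentSpace (𝓡 l)) y₁).symm y (v j)) :
    pushforward B δ y η = ∑ i ∈ s, ∫ u in (extChartAt (𝓡 k) i).target,
      chartPartition k (F y₀) i ((extChartAt (𝓡 k) i).symm u) *
        fiberIntegrand B δ y₀ y₁ i (extChartAt (𝓡 l) y₁ y, u) v := by
  have hy := B.mem_baseSet y
  have h₁' : y ∈ (extChartAt (𝓡 l) y₁).source := by rwa [extChartAt_source]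
  have hM : ∀ i : F y₀, ∀ u ∈ (extChartAt (𝓡 k) i).target,
      fiberDensity B δ y η (fiberTransition B y₀ y y ((extChartAt (𝓡 k) i).symm u))
        (fun a => mfderiv (𝓡 k) (𝓡 k) (fiberTransition B y₀ y y) ((extChartAt (𝓡 k) i).symm u)
          (coordVectors i u a)) =
      fiberIntegrand B δ y₀ y₁ i (extChartAt (𝓡 l) y₁ y, u) v := fun i u hu =>
    (fiberDensity_fiberTransition B δ h₀ η _ _).trans
      (fiberIntegrand_eq B hδ h₀ h₁ i hu v η hη)
  rw [pushforward, integral_comp_diffeo (contMDiff_fiberTransition B h₀ hy)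
    (contMDiff_fiberTransition B hy h₀).continuous (fiberTransition_leftInverse B h₀ hy)
    (fiberTransition_leftInverse B hy h₀) (fiberDensity_comb B hδ y η), integral_eq_sum hs]
  · refine Finset.sum_congr rfl fun i _ => ?_
    refine setIntegral_congr_fun (isOpen_extChartAt_target i).measurableSet fun u hu => ?_
    simp only [hM i u hu]
  · intro j
    refine (continuousOn_fiberIntegrand_right B hc j (mk_mem_totalDomain B hy h₁') v).congr ?_
    intro u hu
    exact fiberIntegrand_eq B hδ hy h₁ j hu v η hη
  · intro i
    exact (continuousOn_fiberIntegrand_right B hc i (mk_mem_totalDomain B h₀ h₁') v).congr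
      fun u hu => hM i u hu

lemma isContinuousField_pushforward {δ : TangentFunction n (q + k) X}
    (hδ : LocallyDecomposable δ) (hc : IsContinuousField δ) :
    IsContinuousField (pushforward B δ) := by
  -- Continuity is tested at `y₀` in the trivialization centered at `y₁`. Hence the bundle is
  -- trivialized at `y₀`, while the chart of `Y` is the one at `y₁`.
  rintro y₁ ⟨y₀, v₀⟩ ⟨hy₀, -⟩
  obtain ⟨s, hs⟩ := exists_finset_chartPartition k (F y₀)
  have hy₀' : y₀ ∈ (chartAt (EuclideanSpace ℝ (Fin l)) y₁).source := hy₀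
  have hW : IsOpen ((chartAt (EuclideanSpace ℝ (Fin l)) y₁).source ∩ (B.triv y₀).baseSet) :=
    (chartAt _ y₁).open_source.inter (B.triv y₀).open_baseSet
  have hWmem := hW.mem_nhds ⟨hy₀', B.mem_baseSet y₀⟩
  refine ContinuousAt.continuousWithinAt ?_
  have hcont : ContinuousAt (fun z : Y × (Fin q → EuclideanSpace ℝ (Fin l)) =>
      ∑ i ∈ s, ∫ u in (extChartAt (𝓡 k) i).target,
      chartPartition k (F y₀) i ((extChartAt (𝓡 k) i).symm u) *
        fiberIntegrand B δ y₀ y₁ i (extChartAt (𝓡 l) y₁ z.1, u) z.2) (y₀, v₀) := by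
    refine tendsto_finsetSum _ fun i _ => ?_
    have hint : ContinuousOn (fun z : EuclideanSpace ℝ (Fin l) ×
        (Fin q → EuclideanSpace ℝ (Fin l)) => ∫ u, (extChartAt (𝓡 k) i).target.indicator (fun u =>
        chartPartition k (F y₀) i ((extChartAt (𝓡 k) i).symm u) *
          fiberIntegrand B δ y₀ y₁ i (z.1, u) z.2) u) (baseDomain B y₀ y₁ ×ˢ univ) := by
      refine continuousOn_integral_of_compact_support (isCompact_weightSupport (k := k) i) ?_ ?_
      · rintro ⟨⟨a, v⟩, u⟩ ⟨⟨ha, -⟩, -⟩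
        refine ContinuousAt.continuousWithinAt ?_
        -- Inside the chart target the integrand is a product of continuous functions. A point
        -- outside it avoids the compact `weightSupport`, near whose complement's points the
        -- extension by zero vanishes identically.
        by_cases hu : u ∈ (extChartAt (𝓡 k) i).target
        · have hopen : ((baseDomain B y₀ y₁ ×ˢ univ) ×ˢ (extChartAt (𝓡 k) i).target :
              Set ((EuclideanSpace ℝ (Fin l) × (Fin q → EuclideanSpace ℝ (Fin l))) ×
                EuclideanSpace ℝ (Fin k))) ∈ 𝓝 ((a, v), u) :=
            (((isOpen_baseDomain B y₀ y₁).prod isOpen_univ).prod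
              (isOpen_extChartAt_target i)).mem_nhds ⟨⟨ha, mem_univ _⟩, hu⟩
          have h1 : ContinuousOn (fun w : (EuclideanSpace ℝ (Fin l) ×
              (Fin q → EuclideanSpace ℝ (Fin l))) × EuclideanSpace ℝ (Fin k) =>
              chartPartition k (F y₀) i ((extChartAt (𝓡 k) i).symm w.2) *
                fiberIntegrand B δ y₀ y₁ i (w.1.1, w.2) w.1.2)
              ((baseDomain B y₀ y₁ ×ˢ univ) ×ˢ (extChartAt (𝓡 k) i).target) := by
            refine ContinuousOn.mul ?_ ?_
            · exact (continuousOn_weight i).comp continuousOn_snd fun w hw => hw.2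
            · exact (continuousOn_fiberIntegrand B hc y₀ y₁ i).comp
                (f := fun w : (EuclideanSpace ℝ (Fin l) × (Fin q → EuclideanSpace ℝ (Fin l))) ×
                  EuclideanSpace ℝ (Fin k) => ((w.1.1, w.2), w.1.2))
                (by fun_prop) fun w hw => ⟨⟨hw.1.1, hw.2⟩, mem_univ _⟩
          refine (h1.continuousAt hopen).congr ?_
          filter_upwards [hopen] with w hw
          exact (indicator_of_mem hw.2 fun u =>
            chartPartition k (F y₀) i ((extChartAt (𝓡 k) i).symm u) *
              fiberIntegrand B δ y₀ y₁ i (w.1.1, u) w.1.2).symm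
        · have hK : (univ ×ˢ (weightSupport (k := k) i)ᶜ :
              Set ((EuclideanSpace ℝ (Fin l) × (Fin q → EuclideanSpace ℝ (Fin l))) ×
                EuclideanSpace ℝ (Fin k))) ∈ 𝓝 ((a, v), u) :=
            (isOpen_univ.prod (isCompact_weightSupport i).isClosed.isOpen_compl).mem_nhds
              ⟨mem_univ _, fun h => hu (weightSupport_subset i h)⟩
          refine (continuousAt_const (y := (0 : ℝ))).congr ?_
          filter_upwards [hK] with w hw
          exact (indicator_weight_mul_eq_zero hw.2 fun u =>
            fiberIntegrand B δ y₀ y₁ i (w.1.1, u) w.1.2).symm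
      · intro z u _ hu
        exact indicator_weight_mul_eq_zero hu _
    simp only [integral_indicator (isOpen_extChartAt_target i).measurableSet] at hint
    have hmem : extChartAt (𝓡 l) y₁ y₀ ∈ baseDomain B y₀ y₁ :=
      mk_mem_totalDomain B (B.mem_baseSet y₀) (by rwa [extChartAt_source])
    have h2 := hint.continuousAt (x := (extChartAt (𝓡 l) y₁ y₀, v₀))
      (((isOpen_baseDomain B y₀ y₁).prod isOpen_univ).mem_nhds ⟨hmem, mem_univ _⟩)
    have h3 : ContinuousAt (fun z : Y × (Fin q → EuclideanSpace ℝ (Fin l)) =>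
        (extChartAt (𝓡 l) y₁ z.1, z.2)) (y₀, v₀) := by
      refine ContinuousAt.prodMk ?_ continuousAt_snd
      exact ContinuousAt.comp (g := extChartAt (𝓡 l) y₁)
        (continuousAt_extChartAt' (by rwa [extChartAt_source])) continuousAt_fst
    exact ContinuousAt.comp (f := fun z : Y × (Fin q → EuclideanSpace ℝ (Fin l)) =>
        (extChartAt (𝓡 l) y₁ z.1, z.2)) h2 h3
  refine hcont.congr ?_
  filter_upwards [prod_mem_nhds hWmem Filter.univ_mem] with z hz
  exact (pushforward_eq_sum B hδ hc hz.1.2 hz.1.1 hs z.2 _ fun _ => rfl).symm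

/-- The contribution of a chart of the fiber to the push-forward is a mixture. -/
lemma isMixture_setIntegral_fiberIntegrand {δ : TangentFunction n (q + k) X}
    (hδ : LocallyDecomposable δ) (hc : IsContinuousField δ) {y₀ y₁ : Y} (i : F y₀)
    {a : EuclideanSpace ℝ (Fin l)} (ha : a ∈ baseDomain B y₀ y₁)
    (L : EuclideanSpace ℝ (Fin l) →L[ℝ] EuclideanSpace ℝ (Fin l)) :
    IsMixture (fun η : Fin q → EuclideanSpace ℝ (Fin l) =>
      ∫ u in (extChartAt (𝓡 k) i).target, chartPartition k (F y₀) i ((extChartAt (𝓡 k) i).symm u) *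
        fiberIntegrand B δ y₀ y₁ i (a, u) (fun j => L (η j))) := by
  have ht := (isOpen_extChartAt_target (I := 𝓡 k) i).measurableSet
  have hcu := fun v => continuousOn_fiberIntegrand_right B hc i ha v
  simp only [← integral_indicator ht]
  refine isMixture_integral volume (fun u η => (extChartAt (𝓡 k) i).target.indicator (fun u =>
    chartPartition k (F y₀) i ((extChartAt (𝓡 k) i).symm u) *
        fiberIntegrand B δ y₀ y₁ i (a, u) (fun j => L (η j))) u) ?_ ?_ ?_
  · intro η
    classical
    have := ((continuousOn_weight i).mul (hcu fun j => L (η j))).measurable_piecewise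
      (continuousOn_const (c := (0 : ℝ))) ht
    simp only [← piecewise_eq_indicator]
    exact this
  · intro η
    exact (integrable_indicator_iff ht).2 (integrableOn_weight_mul i (hcu _))
  · intro u
    by_cases hu : u ∈ (extChartAt (𝓡 k) i).target
    · let T : EuclideanSpace ℝ (Fin l) × EuclideanSpace ℝ (Fin k) →L[ℝ]
          EuclideanSpace ℝ (Fin n) :=
        mfderiv 𝓘(ℝ, EuclideanSpace ℝ (Fin l) × EuclideanSpace ℝ (Fin k)) (𝓡 n)
          (totalChart B y₀ y₁ i) (a, u)
      have hD : IsAbsDecomposable (V := EuclideanSpace ℝ (Fin n))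
        (δ (totalChart B y₀ y₁ i (a, u))) := hδ.isAbsDecomposable _
      obtain ⟨c, ψ, -, h⟩ := hD.contraction fun j => T (0, EuclideanSpace.single j (1 : ℝ))
      -- `S` is the coordinate lift of tangent vectors of `Y`; the factors of the contracted form
      -- are pulled back along it.
      let S : EuclideanSpace ℝ (Fin l) →L[ℝ] EuclideanSpace ℝ (Fin n) :=
        T.comp ((ContinuousLinearMap.inl ℝ (EuclideanSpace ℝ (Fin l))
          (EuclideanSpace ℝ (Fin k))).comp L)
      refine ⟨chartPartition k (F y₀) i ((extChartAt (𝓡 k) i).symm u) * c,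
        fun j => (ψ j).comp S, fun η => ?_⟩
      have h1 : fiberIntegrand B δ y₀ y₁ i (a, u) (fun j => L (η j)) =
          |c * wedge (fun j => (ψ j).comp S) η| := by
        refine Eq.trans ?_ ((h fun j => S (η j)).trans ?_)
        · refine δ.congr rfl fun j => ?_
          refine Fin.addCases (fun j => ?_) (fun j => ?_) j
          · rw [Fin.append_left, coordFrame, Fin.append_left]
            rfl
          · rw [Fin.append_right, coordFrame, Fin.append_right]
            rfl
        · rw [wedge_apply, wedge_apply]
          rfl
      simp only [indicator_of_mem hu]
      rw [h1, mul_assoc, abs_mul (chartPartition k (F y₀) i _),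
        abs_of_nonneg ((chartPartition k (F y₀)).nonneg i _)]
    · exact ⟨0, 0, fun η => by
        simp only [indicator_of_notMem hu, zero_mul, abs_zero]⟩

lemma isMixture_pushforward {δ : TangentFunction n (q + k) X} (hδ : LocallyDecomposable δ)
    (hc : IsContinuousField δ) (y : Y) :
    IsMixture (V := EuclideanSpace ℝ (Fin l)) (pushforward B δ y) := by
  obtain ⟨s, hs⟩ := exists_finset_chartPartition k (F y)
  -- `L` expresses tangent vectors at `y` in the trivialization, whose coordinates enter
  -- `fiberIntegrand`.
  let L : EuclideanSpace ℝ (Fin l) →L[ℝ] EuclideanSpace ℝ (Fin l) :=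
    (trivializationAt (EuclideanSpace ℝ (Fin l)) (TangentSpace (𝓡 l)) y).continuousLinearMapAt ℝ y
  have hb : y ∈ (trivializationAt (EuclideanSpace ℝ (Fin l)) (TangentSpace (𝓡 l)) y).baseSet :=
    mem_baseSet_trivializationAt _ _ _
  have h : pushforward B δ y = fun η => ∑ i ∈ s, ∫ u in (extChartAt (𝓡 k) i).target,
      chartPartition k (F y) i ((extChartAt (𝓡 k) i).symm u) *
        fiberIntegrand B δ y y i (extChartAt (𝓡 l) y y, u) (fun j => L (η j)) := by
    ext η
    refine pushforward_eq_sum B hδ hc (B.mem_baseSet y) (mem_chart_source _ y) hs _ η fun j => ?_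
    have h2 := (trivializationAt (EuclideanSpace ℝ (Fin l)) (TangentSpace (𝓡 l))
      y).symmL_continuousLinearMapAt (R := ℝ) hb (η j)
    rw [Trivialization.symmL_apply _ hb] at h2
    exact h2.symm
  rw [h]
  exact IsMixture.sum s fun i _ => isMixture_setIntegral_fiberIntegrand B hδ hc i
    (mk_mem_totalDomain B (B.mem_baseSet y) (mem_extChartAt_source y)) L

end Main

/-! ### From mixtures and continuous fields to normal densities -/

section Density

variable {V : Type*} [NormedAddCommGroup V] [NormedSpace ℝ V] [FiniteDimensional ℝ V] {q : ℕ}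

lemma IsMixture.isNormal {g : (Fin q → V) → ℝ} (hg : IsMixture g) (hc : Continuous g) :
    IsNormal g := by
  refine ⟨⟨hc, ?_⟩, hg.exists_normalMeasure⟩
  obtain ⟨nu, C, -, -, h⟩ := hg
  intro t ξ η hξ
  rw [h, h, ← integral_const_mul]
  congr 1
  ext φ
  rw [wedge_eq_smul_of_ιMulti_eq φ t ξ η hξ, abs_mul]

/-- A continuous field is continuous on every tangent space. -/
lemma IsContinuousField.continuous_apply {n m : ℕ} {X : Type*} [TopologicalSpace X]
    [ChartedSpace (EuclideanSpace ℝ (Fin n)) X] [IsManifold (𝓡 n) ∞ X] {δ : TangentFunction n m X}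
    (hδ : IsContinuousField δ) (x : X) : Continuous (δ x) := by
  have hb : x ∈ (trivializationAt (EuclideanSpace ℝ (Fin n)) (TangentSpace (𝓡 n)) x).baseSet :=
    mem_baseSet_trivializationAt _ _ _
  let L := (trivializationAt (EuclideanSpace ℝ (Fin n))
    (TangentSpace (𝓡 n)) x).continuousLinearMapAt ℝ x
  have h1 : Continuous fun ξ : Fin m → TangentSpace (𝓡 n) x => (x, fun i => L (ξ i)) :=
    continuous_const.prodMk (continuous_pi fun i => L.continuous.comp (_root_.continuous_apply i))
  have h2 := (hδ x).comp_continuous h1 fun ξ => ⟨hb, mem_univ _⟩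
  convert h2 using 1
  ext ξ
  refine congrArg (δ x) (funext fun i => ?_)
  have h3 := (trivializationAt (EuclideanSpace ℝ (Fin n)) (TangentSpace (𝓡 n))
    x).symmL_continuousLinearMapAt (R := ℝ) hb (ξ i)
  rw [Trivialization.symmL_apply _ hb] at h3
  exact h3.symm

end Density

end NormalDensity

end

theorem mainTheorem3 {n l k q : ℕ}
    {X : Type*} [TopologicalSpace X] [T2Space X] [SecondCountableTopology X]
    [ChartedSpace (EuclideanSpace ℝ (Fin n)) X] [IsManifold (𝓡 n) ∞ X]
    {Y : Type*} [TopologicalSpace Y] [T2Space Y] [SecondCountableTopology Y]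
    [ChartedSpace (EuclideanSpace ℝ (Fin l)) Y] [IsManifold (𝓡 l) ∞ Y]
    {F : Y → Type*} [∀ y, TopologicalSpace (F y)]
    [∀ y, ChartedSpace (EuclideanSpace ℝ (Fin k)) (F y)]
    [∀ y, IsManifold (𝓡 k) ∞ (F y)] [∀ y, CompactSpace (F y)] [∀ y, T2Space (F y)]
    (p : X → Y) (B : NormalDensity.SmoothFiberBundle n l k p F)
    (δ : NormalDensity.TangentFunction n (q + k) X)
    (hδ : NormalDensity.IsNormalField δ)
    (hdec : NormalDensity.LocallyDecomposable δ) :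
    NormalDensity.IsNormalField (NormalDensity.pushforward B δ) := by
  have hc := NormalDensity.isContinuousField_pushforward B hdec hδ.continuous
  exact ⟨fun y => (NormalDensity.isMixture_pushforward B hdec hδ.continuous y).isNormal
    (hc.continuous_apply y), hc⟩
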